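/- Let $U\subseteq\mathbb R^n$ be open, with coordinates $u^1,\dots,u^n$, and let $g^{ij}(u)$ be a smooth, symmetric, nondegenerate (of any signature) contravariant metric on $U$ that is flat, with Levi-Civita connection $\nabla$ and Christoffel symbols $\Gamma^j_{sk}$. Let $h$ be a smooth function on $U$ and consider the Hamiltonian system $$u^i_t=v^i_j(u)\,u^j_x=J^{ij}\frac{\partial h}{\partial u^j},\qquad J^{ij}=g^{ij}\frac{d}{dx}-g^{is}\Gamma^j_{sk}u^k_x ,\qquad v^i_j=\nabla^i\nabla_jh .$$ Let $B(u)\,dx+A(u)\,dt$ be a conservation law of this system ($A,B$ smooth; $B_t=A_x$ by virtue of the system) with $B\neq0$ on $U$. Put $\tilde g^{ij}=B^2g^{ij}$, let $\tilde\nabla$, $\tilde\Gamma$ be the Levi-Civita connection of $\tilde g$ and its Christoffel symbols, and let $$\tilde w^i_j=B\,\nabla^i\nabla_jB-\tfrac12(\nabla B)^2\delta^i_j,\qquad (\nabla B)^2=g^{ij}\,\partial_iB\,\partial_jB,\qquad \tilde h=h/B .$$ 1. Under the reciprocal transformation $d\tilde x=B\,dx+A\,dt$, $\tilde t=t$, solutions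 of the system become solutions of $u^i_t=\tilde v^i_ju^j_{\tilde x}$ with $\tilde v^i_j=B\,\nabla^i\nabla_jh-A\,\delta^i_j$. 2. The operator $$\tilde J^{ij}=\tilde g^{ij}\frac{d}{d\tilde x}-\tilde g^{is}\tilde\Gamma^j_{sk}u^k_{\tilde x}+\tilde w^i_ku^k_{\tilde x}\Big(\frac{d}{d\tilde x}\Big)^{-1}u^j_{\tilde x}+u^i_{\tilde x}\Big(\frac{d}{d\tilde x}\Big)^{-1}\tilde w^j_ku^k_{\tilde x}$$ is Hamiltonian: the bracket $\{F,K\}=\int\frac{\delta F}{\delta u^i}\tilde J^{ij}\frac{\delta K}{\delta u^j}\,d\tilde x$, with $(d/d\tilde x)^{-1}f=\frac12\big(\int_{-\infty}^{\tilde x}f-\int_{\tilde x}^{\infty}f\big)$, is skew-symmetric and satisfies the Jacobi identity on smooth fields $u:\mathbb R\to U$ (for functionals with compactly supported variational derivatives). 3. The transformed system is Hamiltonian with this operator and the density $\tilde h$: $$\tilde v^i_j\,u^j_{\tilde x}=\tilde J^{ij}\frac{\partial\tilde h}{\partial u^j}.$$ Here $(d/d\tilde x)^{-1}\big(u^j_{\tilde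 x}\partial_j\tilde h\big)=\tilde h$ and $(d/d\tilde x)^{-1}\big(\tilde w^j_ku^k_{\tilde x}\partial_j\tilde h\big)=P(u)$, where $P$ is a smooth function on $U$ with $\partial_kP=\tilde w^j_k\partial_j\tilde h$ (part of the claim is that a suitable $P$ exists). 4. The metric $\tilde g$ is conformally flat, and $\tilde J$ is an operator of conformally flat type: $\tilde g_{is}\tilde w^s_j=\tilde g_{js}\tilde w^s_i$, $\ \tilde\nabla_k\tilde w^i_j=\tilde\nabla_j\tilde w^i_k$, and the curvature tensor of $\tilde g$ is $$\tilde R^{ij}_{kl}=\tilde w^i_k\delta^j_l+\tilde w^j_l\delta^i_k-\tilde w^j_k\delta^i_l-\tilde w^i_l\delta^j_k ,$$ where the sign of the curvature is such that $R^{ij}_{kl}=c(\delta^i_k\delta^j_l-\delta^i_l\delta^j_k)$ for a metric of constant curvature $c$. -/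

import Mathlib

open scoped ContDiff

noncomputable section

namespace HydroRecip

/-! Tensor calculus on an open subset of `ℝⁿ`; a metric is given by its contravariant
components `G p i j = g^{ij}(p)`. -/

/-- The coordinate space of the field variables `u¹, …, uⁿ`. -/
abbrev V (n : ℕ) : Type := Fin n → ℝ

/-- The partial derivative `∂f/∂uᵏ` at `p`. -/
def pd {n : ℕ} (k : Fin n) (f : V n → ℝ) (p : V n) : ℝ :=
  fderiv ℝ f p (Pi.single k 1)

/-- A smooth, symmetric, nondegenerate (of any signature) contravariant metric on `U`. -/
structure IsMetric {n : ℕ} (U : Set (V n)) (G : V n → Matrix (Fin n) (Fin n) ℝ) : Prop where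
  smooth : ∀ i j, ContDiffOn ℝ ∞ (fun p => G p i j) U
  symm : ∀ p ∈ U, ∀ i j, G p i j = G p j i
  nondeg : ∀ p ∈ U, (G p).det ≠ 0

/-- The Christoffel symbols `Γ^j_{sk}` of the Levi-Civita connection of the metric; the covariant
components `g_{ij}` are the entries of the inverse matrix `(G p)⁻¹`. -/
def christoffel {n : ℕ} (G : V n → Matrix (Fin n) (Fin n) ℝ) (p : V n) (j s k : Fin n) : ℝ :=
  (1 / 2) * ∑ m, G p j m *
    (pd s (fun q => (G q)⁻¹ m k) p + pd k (fun q => (G q)⁻¹ m s) p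
      - pd m (fun q => (G q)⁻¹ s k) p)

/-- The Riemann tensor
`R^i_{jkl} = ∂_k Γ^i_{lj} - ∂_l Γ^i_{kj} + Γ^i_{km} Γ^m_{lj} - Γ^i_{lm} Γ^m_{kj}`. -/
def riemann {n : ℕ} (G : V n → Matrix (Fin n) (Fin n) ℝ) (p : V n) (i j k l : Fin n) : ℝ :=
  pd k (fun q => christoffel G q i l j) p - pd l (fun q => christoffel G q i k j) p
    + ∑ m, (christoffel G p i k m * christoffel G p m l j
      - christoffel G p i l m * christoffel G p m k j)

/-- The curvature with two raised indices, `R^{ij}_{kl} = g^{jm} R^i_{mkl}`; with this sign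
`R^{ij}_{kl} = c (δ^i_k δ^j_l - δ^i_l δ^j_k)` for a metric of constant curvature `c`. -/
def curvature {n : ℕ} (G : V n → Matrix (Fin n) (Fin n) ℝ) (p : V n) (i j k l : Fin n) : ℝ :=
  ∑ m, G p j m * riemann G p i m k l

/-- The metric is flat on `U`. -/
def IsFlat {n : ℕ} (U : Set (V n)) (G : V n → Matrix (Fin n) (Fin n) ℝ) : Prop :=
  ∀ p ∈ U, ∀ i j k l, riemann G p i j k l = 0

/-- The metric is conformally flat on `U`: near each point a positive multiple of it is flat. -/
def IsConformallyFlat {n : ℕ} (U : Set (V n)) (G : V n → Matrix (Fin n) (Fin n) ℝ) : Prop :=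
  ∀ p ∈ U, ∃ W : Set (V n), IsOpen W ∧ p ∈ W ∧ W ⊆ U ∧ ∃ c : V n → ℝ,
    ContDiffOn ℝ ∞ c W ∧ (∀ q ∈ W, 0 < c q) ∧
      IsMetric W (fun q => c q • G q) ∧ IsFlat W (fun q => c q • G q)

/-- `∇^i ∇_j f = g^{is} (∂_s ∂_j f - Γ^k_{sj} ∂_k f)`. -/
def hess {n : ℕ} (G : V n → Matrix (Fin n) (Fin n) ℝ) (f : V n → ℝ) (p : V n) :
    Matrix (Fin n) (Fin n) ℝ :=
  Matrix.of fun i j =>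
    ∑ s, G p i s * (pd s (fun q => pd j f q) p - ∑ k, christoffel G p k s j * pd k f p)

/-- `(∇f)² = g^{ij} ∂_i f ∂_j f`. -/
def gradSq {n : ℕ} (G : V n → Matrix (Fin n) (Fin n) ℝ) (f : V n → ℝ) (p : V n) : ℝ :=
  ∑ i, ∑ j, G p i j * pd i f p * pd j f p

/-- The covariant derivative `∇_k w^i_j` of an affinor `w p i j = w^i_j(p)`. -/
def covDeriv {n : ℕ} (G w : V n → Matrix (Fin n) (Fin n) ℝ) (p : V n) (k i j : Fin n) : ℝ :=
  pd k (fun q => w q i j) p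
    + ∑ m, (christoffel G p i k m * w p m j - christoffel G p m k j * w p i m)

/-! Operators of hydrodynamic type. -/

/-- The skew-symmetric inverse of `d/dx`:
`(d/dx)⁻¹ f (x) = ½ (∫_{-∞}^x f - ∫_x^∞ f)`. -/
def dInv (f : ℝ → ℝ) (x : ℝ) : ℝ :=
  (1 / 2) * ((∫ y in Set.Iic x, f y) - ∫ y in Set.Ioi x, f y)

/-- The data of an operator of hydrodynamic type with a tail of `m` terms,
`g^{ij} d/dx - g^{is} Γ^j_{sk} u_x^k + ∑_α a_α^i_k u_x^k (d/dx)⁻¹ b_α^j_l u_x^l`,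
where `Γ` is the Levi-Civita connection of `g`. It is local if `m = 0`. -/
structure HydroOp (n m : ℕ) where
  /-- the contravariant metric -/
  metric : V n → Matrix (Fin n) (Fin n) ℝ
  /-- the affinors to the left of `(d/dx)⁻¹` -/
  left : Fin m → V n → Matrix (Fin n) (Fin n) ℝ
  /-- the affinors to the right of `(d/dx)⁻¹` -/
  right : Fin m → V n → Matrix (Fin n) (Fin n) ℝ

namespace HydroOp

variable {n m : ℕ}

/-- The function `b_α^j_l u_x^l ψ_j` of `x`, to which `(d/dx)⁻¹` is applied in the
`α`-th term of the tail. -/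
def integrand (O : HydroOp n m) (u ψ : ℝ → V n) (α : Fin m) (x : ℝ) : ℝ :=
  ∑ j, ∑ l, O.right α (u x) j l * deriv u x l * ψ x j

/-- The value of the operator at the field `u` on the covector field `ψ`, when `φ α` is the
primitive chosen for `O.integrand u ψ α`. -/
def act (O : HydroOp n m) (u ψ : ℝ → V n) (φ : Fin m → ℝ → ℝ) (x : ℝ) : V n := fun i =>
  (∑ j, O.metric (u x) i j * deriv ψ x j)
    - (∑ j, ∑ s, ∑ k,
        O.metric (u x) i s * christoffel O.metric (u x) j s k * deriv u x k * ψ x j)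
    + ∑ α, (∑ k, O.left α (u x) i k * deriv u x k) * φ α x

/-- The operator on compactly supported covector fields `ψ`, where `(d/dx)⁻¹` is the
skew-symmetric primitive. -/
def op (O : HydroOp n m) (u ψ : ℝ → V n) : ℝ → V n :=
  O.act u ψ (fun α => dInv (O.integrand u ψ α))

end HydroOp

/-- The local operator `g^{ij} d/dx - g^{is} Γ^j_{sk} u_x^k`. -/
def localOp {n : ℕ} (G : V n → Matrix (Fin n) (Fin n) ℝ) : HydroOp n 0 where
  metric := G
  left := ![]
  right := ![]

/-- The operator of conformally flat type `g^{ij} d/dx - g^{is} Γ^j_{sk} u_x^k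
+ w^i_k u_x^k (d/dx)⁻¹ u_x^j + u_x^i (d/dx)⁻¹ w^j_k u_x^k`. -/
def conformalOp {n : ℕ} (G w : V n → Matrix (Fin n) (Fin n) ℝ) : HydroOp n 2 where
  metric := G
  left := ![w, fun _ => 1]
  right := ![fun _ => 1, w]

/-- The pairing `∫ ξ_i v^i dx`. -/
def pairing {n : ℕ} (ξ v : ℝ → V n) : ℝ := ∫ x, ∑ i, ξ x i * v x i

/-- Smooth compactly supported covector fields. -/
def IsTest {n : ℕ} (ξ : ℝ → V n) : Prop := ContDiff ℝ ∞ ξ ∧ HasCompactSupport ξ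

/-- `J` is a Hamiltonian operator on the smooth fields `u : ℝ → U`: the bracket
`{F, K} = ∫ δF/δuⁱ J^{ij} δK/δuʲ dx` is skew-symmetric and satisfies the Jacobi identity.
For the functionals `F_ξ(u) = ∫ ξ_i(x) uⁱ(x) dx` one has `{F_η, F_ζ}(u) = ∫ η · J(u) ζ dx` and
`{F_ξ, K}(u) = - d/dε K(u + ε J(u) ξ)` at `ε = 0`. These functionals determine the bracket (its
distribution kernel `{uⁱ(x), uʲ(y)}`), and the Jacobi identity for them is the identity for all. -/
def IsHamiltonianOperator {n : ℕ} (U : Set (V n)) (J : (ℝ → V n) → (ℝ → V n) → ℝ → V n) : Prop :=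
  ∀ u : ℝ → V n, ContDiff ℝ ∞ u → (∀ x, u x ∈ U) →
    (∀ ξ, IsTest ξ → ContDiff ℝ ∞ (J u ξ)) ∧
    (∀ ξ η, IsTest ξ → IsTest η → pairing ξ (J u η) = - pairing η (J u ξ)) ∧
    (∀ ξ η ζ, IsTest ξ → IsTest η → IsTest ζ → ∃ a b c : ℝ,
      HasDerivAt (fun ε : ℝ => pairing η (J (u + ε • J u ξ) ζ)) a 0 ∧
      HasDerivAt (fun ε : ℝ => pairing ζ (J (u + ε • J u η) ξ)) b 0 ∧
      HasDerivAt (fun ε : ℝ => pairing ξ (J (u + ε • J u ζ) η)) c 0 ∧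
      a + b + c = 0)

/-- The covector field `∂h/∂uʲ` along `u`. -/
def gradAlong {n : ℕ} (h : V n → ℝ) (u : ℝ → V n) (x : ℝ) : V n := fun j => pd j h (u x)

/-- The system `u_t = v(u) u_x` is the Hamiltonian system `u_t^i = J^{ij} ∂h/∂uʲ` on `U`, where
`J` is the operator `O` and `(d/dx)⁻¹`, applied to the expressions `b_α^j_l u_x^l ∂h/∂uʲ`, gives
the functions `Q α` of `u`, whose `x`-derivatives they are. -/
structure IsHamiltonianSystem {n m : ℕ} (U : Set (V n)) (v : V n → Matrix (Fin n) (Fin n) ℝ)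
    (O : HydroOp n m) (h : V n → ℝ) (Q : Fin m → V n → ℝ) : Prop where
  smooth : ∀ α, ContDiffOn ℝ ∞ (Q α) U
  primitive : ∀ (u : ℝ → V n) (x : ℝ), ContDiffAt ℝ ∞ u x → u x ∈ U →
    ∀ α, HasDerivAt (fun y => Q α (u y)) (O.integrand u (gradAlong h u) α x) x
  flow : ∀ (u : ℝ → V n) (x : ℝ), ContDiffAt ℝ ∞ u x → u x ∈ U →
    (v (u x)).mulVec (deriv u x) = O.act u (gradAlong h u) (fun α y => Q α (u y)) x

/-- `B(u) dx + A(u) dt` is a conservation law of `u_t = v(u) u_x`: it is closed by virtue of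
the system, that is, `B_t = A_x` for all values `η` of `u_x`, once `u_t = v η` is inserted. -/
def IsConservationLaw {n : ℕ} (U : Set (V n)) (v : V n → Matrix (Fin n) (Fin n) ℝ)
    (B A : V n → ℝ) : Prop :=
  ∀ p ∈ U, ∀ η : V n, fderiv ℝ B p ((v p).mulVec η) = fderiv ℝ A p η

/-- `u` is a smooth solution with values in `U` of `u_t = v(u) u_x` on the open set `D` of the
`(x, t)`-plane. -/
structure IsSolution {n : ℕ} (U : Set (V n)) (v : V n → Matrix (Fin n) (Fin n) ℝ)
    (D : Set (ℝ × ℝ)) (u : ℝ × ℝ → V n) : Prop where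
  isOpen : IsOpen D
  smooth : ContDiffOn ℝ ∞ u D
  mem : ∀ z ∈ D, u z ∈ U
  eq : ∀ z ∈ D, deriv (fun t => u (z.1, t)) z.2 =
    (v (u z)).mulVec (deriv (fun x => u (x, z.2)) z.1)

/-- `X` is the new variable `x̃`, with `dx̃ = B(u) dx + A(u) dt` and `t̃ = t`, and `u'` is the
field `u` on `D`, expressed through `(x̃, t)`. -/
structure IsReciprocal {n : ℕ} (B A : V n → ℝ) (D : Set (ℝ × ℝ)) (u : ℝ × ℝ → V n)
    (X : ℝ × ℝ → ℝ) (u' : ℝ × ℝ → V n) : Prop where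
  dX : ∀ z ∈ D, HasFDerivAt X
    (B (u z) • ContinuousLinearMap.fst ℝ ℝ ℝ + A (u z) • ContinuousLinearMap.snd ℝ ℝ ℝ) z
  field : ∀ z ∈ D, u' (X z, z.2) = u z

/-- The matrix `B v - A E` of the transformed system. -/
def newMatrix {n : ℕ} (v : V n → Matrix (Fin n) (Fin n) ℝ) (B A : V n → ℝ) (p : V n) :
    Matrix (Fin n) (Fin n) ℝ :=
  B p • v p - A p • (1 : Matrix (Fin n) (Fin n) ℝ)

/-- The transformed contravariant metric `B² g^{ij}`. -/
def newMetric {n : ℕ} (G : V n → Matrix (Fin n) (Fin n) ℝ) (B : V n → ℝ) (p : V n) :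
    Matrix (Fin n) (Fin n) ℝ :=
  (B p) ^ 2 • G p

/-- The affinor `B ∇^i ∇_j B - ½ (∇B)² δ^i_j` of the new tail. -/
def newTail {n : ℕ} (G : V n → Matrix (Fin n) (Fin n) ℝ) (B : V n → ℝ) (p : V n) :
    Matrix (Fin n) (Fin n) ℝ :=
  B p • hess G B p - ((1 / 2) * gradSq G B p) • (1 : Matrix (Fin n) (Fin n) ℝ)

end HydroRecip

end

/-!
Under `g̃ = B² g` the Christoffel symbols change by terms linear in `dB / B`. For flat `g`, the
Ricci identity says that `∇∇B` is a Codazzi tensor, and the curvature of the changed symbols is the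
wedge product of `w̃ = B ∇∇B - ½ (∇B)²` with the identity, while `∇̃ w̃` is again symmetric.

For the Jacobi identity only these properties of a pair `(g, w)` matter. Write the operator as
`J ζ = g D_x ζ + M_ζ u_x`, where `M_ζ` is a combination of `w` and the identity whose coefficients
are the nonlocal primitives. The derivative of `∫ η · J ζ` along a field `X` is, by the Codazzi
equations and the form of the curvature, minus the integral of
`η · Γ(X) J ζ - ζ · Γ(X) J η + D_x η · M_ζ X - D_x ζ · M_η X`, up to a total derivative. For
`X = J ξ` the cyclic sum of these densities vanishes pointwise: `Γ` and `M_ζ g` are symmetric, and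
the matrices `M` commute.

For the transformed flow, put `h = B f` in `v = ∇∇h`. The Leibniz rule for the Hessian turns
`B v - A` into the action of `J̃` on `df`, with the tail primitives `f` and
`B ⟨∇B, ∇f⟩ + ½ f (∇B)² - A`; that the second one is a primitive is the conservation law
`B_t = A_x`.
-/

noncomputable section

namespace HydroRecip

open scoped Topology Matrix Matrix.Norms.Elementwise

section Calculus

variable {l m n : ℕ} {E : Type*} [NormedAddCommGroup E] [NormedSpace ℝ E] {s : Set E} {p : E}
  {M : E → Matrix (Fin m) (Fin n) ℝ} {F F' : E → V n}

theorem contDiffOn_matrix :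
    ContDiffOn ℝ ∞ M s ↔ ∀ i j, ContDiffOn ℝ ∞ (fun q => M q i j) s :=
  contDiffOn_pi.trans (forall_congr' fun _ => contDiffOn_pi)

theorem fderiv_matrix_apply (hM : DifferentiableAt ℝ M p) (X : E) (i : Fin m) (j : Fin n) :
    fderiv ℝ (fun q => M q i j) p X = fderiv ℝ M p X i j := by
  have h := hasFDerivAt_pi'.1 (hasFDerivAt_pi'.1 hM.hasFDerivAt i) j
  exact congrArg (· X) h.fderiv

theorem fderiv_matrix_mul {M : E → Matrix (Fin l) (Fin m) ℝ} {N : E → Matrix (Fin m) (Fin n) ℝ}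
    (hM : DifferentiableAt ℝ M p) (hN : DifferentiableAt ℝ N p) (X : E) :
    fderiv ℝ (fun q => M q * N q) p X = M p * fderiv ℝ N p X + fderiv ℝ M p X * N p :=
  congrArg (· X) ((mulLinearMap (n := Fin n) ℝ).toContinuousBilinearMap.hasFDerivAt_of_bilinear
    hM.hasFDerivAt hN.hasFDerivAt).fderiv

theorem fderiv_mulVec (hM : DifferentiableAt ℝ M p) (hF : DifferentiableAt ℝ F p) (X : E) :
    fderiv ℝ (fun q => M q *ᵥ F q) p X = M p *ᵥ fderiv ℝ F p X + fderiv ℝ M p X *ᵥ F p :=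
  congrArg (· X) ((Matrix.mulVecBilin ℝ ℝ).toContinuousBilinearMap.hasFDerivAt_of_bilinear
    hM.hasFDerivAt hF.hasFDerivAt).fderiv

theorem fderiv_mulVec_const (hM : DifferentiableAt ℝ M p) (Y : V n) (X : E) :
    fderiv ℝ (fun q => M q *ᵥ Y) p X = fderiv ℝ M p X *ᵥ Y := by
  simp [fderiv_mulVec hM (differentiableAt_const Y)]

theorem fderiv_dotProduct (hF : DifferentiableAt ℝ F p) (hF' : DifferentiableAt ℝ F' p) (X : E) :
    fderiv ℝ (fun q => F q ⬝ᵥ F' q) p X = F p ⬝ᵥ fderiv ℝ F' p X + fderiv ℝ F p X ⬝ᵥ F' p :=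
  congrArg (· X) ((dotProductBilin ℝ ℝ).toContinuousBilinearMap.hasFDerivAt_of_bilinear
    hF.hasFDerivAt hF'.hasFDerivAt).fderiv

theorem fderiv_transpose (hM : DifferentiableAt ℝ M p) (X : E) :
    fderiv ℝ (fun q => (M q)ᵀ) p X = (fderiv ℝ M p X)ᵀ :=
  congrArg (· X) ((Matrix.transposeLinearEquiv (Fin m) (Fin n) ℝ ℝ).toLinearMap
    |>.toContinuousLinearMap.hasFDerivAt.comp p hM.hasFDerivAt).fderiv

@[fun_prop]
theorem contDiffOn_dotProduct (hF : ContDiffOn ℝ ∞ F s) (hF' : ContDiffOn ℝ ∞ F' s) :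
    ContDiffOn ℝ ∞ (fun q => F q ⬝ᵥ F' q) s :=
  ContDiffOn.sum fun i _ => (contDiffOn_pi.1 hF i).mul (contDiffOn_pi.1 hF' i)

@[fun_prop]
theorem contDiffOn_mulVec (hM : ContDiffOn ℝ ∞ M s) (hF : ContDiffOn ℝ ∞ F s) :
    ContDiffOn ℝ ∞ (fun q => M q *ᵥ F q) s :=
  contDiffOn_pi.2 fun i => contDiffOn_dotProduct (contDiffOn_pi.1 hM i) hF

@[fun_prop]
theorem contDiffOn_transpose (hM : ContDiffOn ℝ ∞ M s) :
    ContDiffOn ℝ ∞ (fun q => (M q)ᵀ) s :=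
  contDiffOn_matrix.2 fun i j => contDiffOn_matrix.1 hM j i

@[fun_prop]
theorem contDiffOn_matrix_mul {M : E → Matrix (Fin l) (Fin m) ℝ} {N : E → Matrix (Fin m) (Fin n) ℝ}
    (hM : ContDiffOn ℝ ∞ M s) (hN : ContDiffOn ℝ ∞ N s) :
    ContDiffOn ℝ ∞ (fun q => M q * N q) s :=
  contDiffOn_matrix.2 fun i j => contDiffOn_dotProduct (contDiffOn_pi.1 hM i)
    (contDiffOn_pi.2 fun k => contDiffOn_matrix.1 hN k j)

theorem fderiv_matrix_smul {B : E → ℝ} (hB : DifferentiableAt ℝ B p) (hM : DifferentiableAt ℝ M p)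
    (X : E) : fderiv ℝ (fun q => B q • M q) p X = B p • fderiv ℝ M p X + fderiv ℝ B p X • M p :=
  congrArg (· X) (fderiv_fun_smul hB hM)

theorem contDiffOn_det {M : E → Matrix (Fin n) (Fin n) ℝ} (hM : ContDiffOn ℝ ∞ M s) :
    ContDiffOn ℝ ∞ (fun q => (M q).det) s := by
  simp only [Matrix.det_apply']
  exact ContDiffOn.sum fun σ _ => contDiffOn_const.mul
    (contDiffOn_prod fun i _ => contDiffOn_matrix.1 hM _ _)

theorem contDiffOn_matrix_inv {M : E → Matrix (Fin n) (Fin n) ℝ} (hM : ContDiffOn ℝ ∞ M s)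
    (h0 : ∀ q ∈ s, (M q).det ≠ 0) : ContDiffOn ℝ ∞ (fun q => (M q)⁻¹) s := by
  refine contDiffOn_matrix.2 fun i j => ?_
  simp only [Matrix.inv_def, Matrix.smul_apply, Ring.inverse_eq_inv', smul_eq_mul,
    Matrix.adjugate_apply]
  refine ((contDiffOn_det hM).inv h0).mul (contDiffOn_det (contDiffOn_matrix.2 fun a b => ?_))
  simp only [Matrix.updateRow_apply]
  split_ifs
  · exact contDiffOn_const
  · exact contDiffOn_matrix.1 hM a b

variable {E' : Type*} [NormedAddCommGroup E'] [NormedSpace ℝ E'] {f : E → E'}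

theorem differentiableAt_of_contDiffOn (hs : IsOpen s) (hf : ContDiffOn ℝ ∞ f s) (hp : p ∈ s) :
    DifferentiableAt ℝ f p :=
  (hf.contDiffAt (hs.mem_nhds hp)).differentiableAt (by simp)

theorem contDiffOn_fderiv_apply (hs : IsOpen s) (hf : ContDiffOn ℝ ∞ f s) (X : E) :
    ContDiffOn ℝ ∞ (fun q => fderiv ℝ f q X) s :=
  (hf.fderiv_of_isOpen hs (m := ∞) (by simp)).clm_apply contDiffOn_const

theorem fderiv_fderiv_apply_comm (hs : IsOpen s) (hf : ContDiffOn ℝ ∞ f s) (hp : p ∈ s) (X Y : E) :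
    fderiv ℝ (fun q => fderiv ℝ f q Y) p X = fderiv ℝ (fun q => fderiv ℝ f q X) p Y := by
  have hc := hf.contDiffAt (hs.mem_nhds hp)
  have hd : DifferentiableAt ℝ (fderiv ℝ f) p :=
    (hc.fderiv_right (m := ∞) (by simp)).differentiableAt (by simp)
  have hsymm : IsSymmSndFDerivAt ℝ f p :=
    hc.isSymmSndFDerivAt (by simpa using WithTop.coe_le_coe.2 (le_top : (2 : ℕ∞) ≤ ⊤))
  have hsnd (X Y : E) : fderiv ℝ (fun q => fderiv ℝ f q Y) p X = fderiv ℝ (fderiv ℝ f) p X Y := by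
    rw [fderiv_clm_apply hd (by fun_prop)]
    simp
  rw [hsnd, hsnd, hsymm.eq]

theorem fderiv_eq_of_eqOn {g : E → E'} (hs : IsOpen s) (hp : p ∈ s) (h : Set.EqOn f g s) :
    fderiv ℝ f p = fderiv ℝ g p :=
  (h.eventuallyEq_of_mem (hs.mem_nhds hp)).fderiv_eq

end Calculus

section Gradient

variable {n : ℕ} {U : Set (V n)} {p : V n} {f : V n → ℝ}

/-- The differential of `f`, as the vector of its partial derivatives. -/
def grad (f : V n → ℝ) (p : V n) : V n := fun k => pd k f p

theorem fderiv_eq_grad_dotProduct (f : V n → ℝ) (p X : V n) :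
    fderiv ℝ f p X = grad f p ⬝ᵥ X := by
  have hX : X = ∑ k, X k • (Pi.single k 1 : V n) := by ext i; simp [Pi.single_apply]
  conv_lhs => rw [hX, map_sum]
  exact Finset.sum_congr rfl fun k _ => by rw [map_smul, smul_eq_mul, mul_comm]; rfl

theorem contDiffOn_grad (hU : IsOpen U) (hf : ContDiffOn ℝ ∞ f U) : ContDiffOn ℝ ∞ (grad f) U :=
  contDiffOn_pi.2 fun k => contDiffOn_fderiv_apply hU hf (Pi.single k 1)

theorem fderiv_grad_dotProduct_comm (hU : IsOpen U) (hf : ContDiffOn ℝ ∞ f U) (hp : p ∈ U)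
    (X Y : V n) : fderiv ℝ (grad f) p X ⬝ᵥ Y = fderiv ℝ (grad f) p Y ⬝ᵥ X := by
  have hd := differentiableAt_of_contDiffOn hU (contDiffOn_grad hU hf) hp
  have h (X Y : V n) : fderiv ℝ (grad f) p X ⬝ᵥ Y = fderiv ℝ (fun q => fderiv ℝ f q Y) p X := by
    rw [funext fun q => fderiv_eq_grad_dotProduct f q Y,
      fderiv_dotProduct hd (differentiableAt_const Y)]
    simp
  rw [h, h, fderiv_fderiv_apply_comm hU hf hp]

end Gradient

section LeviCivita

variable {n : ℕ} {U : Set (V n)} {G : V n → Matrix (Fin n) (Fin n) ℝ} {p : V n}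

/-- The connection matrix `Γ(X)` of the Levi-Civita connection in the direction `X`, with entries
`Γ^i_{kj} X^k`; the covariant derivative of a vector field `Y` along `X` is `D_X Y + Γ(X) Y`. -/
def conn (G : V n → Matrix (Fin n) (Fin n) ℝ) (p X : V n) : Matrix (Fin n) (Fin n) ℝ :=
  .of fun i j => ∑ k, christoffel G p i k j * X k

/-- The curvature operator `R(X, Y) = D_X Γ(Y) - D_Y Γ(X) + [Γ(X), Γ(Y)]`, for constant vector
fields `X` and `Y`. -/
def curvOp (G : V n → Matrix (Fin n) (Fin n) ℝ) (p X Y : V n) : Matrix (Fin n) (Fin n) ℝ :=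
  fderiv ℝ (fun q => conn G q Y) p X - fderiv ℝ (fun q => conn G q X) p Y
    + (conn G p X * conn G p Y - conn G p Y * conn G p X)

/-- The covariant derivative of the affinor `a` is symmetric: `∇_k a^i_j = ∇_j a^i_k`. -/
def IsCodazzi (U : Set (V n)) (G a : V n → Matrix (Fin n) (Fin n) ℝ) : Prop :=
  ∀ p ∈ U, ∀ X Y, fderiv ℝ a p X *ᵥ Y + conn G p X *ᵥ a p *ᵥ Y
    = fderiv ℝ a p Y *ᵥ X + conn G p Y *ᵥ a p *ᵥ X

theorem conn_single (G : V n → Matrix (Fin n) (Fin n) ℝ) (p : V n) (i k j : Fin n) :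
    conn G p (Pi.single k 1) i j = christoffel G p i k j := by
  simp [conn, Pi.single_apply]

namespace IsMetric

theorem contDiffOn (hG : IsMetric U G) : ContDiffOn ℝ ∞ G U := contDiffOn_matrix.2 hG.smooth

theorem contDiffOn_inv (hG : IsMetric U G) : ContDiffOn ℝ ∞ (fun q => (G q)⁻¹) U :=
  contDiffOn_matrix_inv hG.contDiffOn hG.nondeg

theorem mul_inv (hG : IsMetric U G) (hp : p ∈ U) : G p * (G p)⁻¹ = 1 :=
  Matrix.mul_nonsing_inv _ (hG.nondeg p hp).isUnit

theorem inv_mul (hG : IsMetric U G) (hp : p ∈ U) : (G p)⁻¹ * G p = 1 :=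
  Matrix.nonsing_inv_mul _ (hG.nondeg p hp).isUnit

theorem isSymm (hG : IsMetric U G) (hp : p ∈ U) : (G p).IsSymm :=
  Matrix.IsSymm.ext fun i j => hG.symm p hp j i

theorem isSymm_inv (hG : IsMetric U G) (hp : p ∈ U) : (G p)⁻¹.IsSymm := by
  rw [Matrix.IsSymm, Matrix.transpose_nonsing_inv, hG.isSymm hp]

theorem christoffel_symm (hU : IsOpen U) (hG : IsMetric U G) (hp : p ∈ U) (j s k : Fin n) :
    christoffel G p j s k = christoffel G p j k s := by
  have h (m : Fin n) : pd m (fun q => (G q)⁻¹ s k) p = pd m (fun q => (G q)⁻¹ k s) p := by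
    simp only [pd, fderiv_eq_of_eqOn hU hp fun _ hq => (hG.isSymm_inv hq).apply k s]
  simp only [christoffel, h]
  exact congrArg _ (Finset.sum_congr rfl fun m _ => by ring)

theorem contDiffOn_christoffel (hU : IsOpen U) (hG : IsMetric U G) (j s k : Fin n) :
    ContDiffOn ℝ ∞ (fun q => christoffel G q j s k) U := by
  have h1 := hG.smooth
  have h2 (i a b : Fin n) : ContDiffOn ℝ ∞ (fun q => pd i (fun r => (G r)⁻¹ a b) q) U :=
    contDiffOn_fderiv_apply hU (contDiffOn_matrix.1 hG.contDiffOn_inv a b) _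
  unfold christoffel
  fun_prop

theorem contDiffOn_conn (hU : IsOpen U) (hG : IsMetric U G) (X : V n) :
    ContDiffOn ℝ ∞ (fun q => conn G q X) U := by
  have hΓ := hG.contDiffOn_christoffel hU
  refine contDiffOn_matrix.2 fun i j => ?_
  simp only [conn, Matrix.of_apply]
  fun_prop

theorem conn_mulVec_comm (hU : IsOpen U) (hG : IsMetric U G) (hp : p ∈ U) (X Y : V n) :
    conn G p X *ᵥ Y = conn G p Y *ᵥ X := by
  ext i
  simp only [conn, Matrix.mulVec, dotProduct, Matrix.of_apply, Finset.sum_mul]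
  rw [Finset.sum_comm]
  refine Finset.sum_congr rfl fun k _ => Finset.sum_congr rfl fun j _ => ?_
  rw [hG.christoffel_symm hU hp]
  ring

theorem inv_mul_conn_apply (hG : IsMetric U G) (hp : p ∈ U) (X : V n) (i j : Fin n) :
    ((G p)⁻¹ * conn G p X) i j = ∑ k, (1 / 2) * (pd k (fun q => (G q)⁻¹ i j) p
      + pd j (fun q => (G q)⁻¹ i k) p - pd i (fun q => (G q)⁻¹ k j) p) * X k := by
  let L : Matrix (Fin n) (Fin n) ℝ := .of fun m s => ∑ k, (1 / 2) *
    (pd k (fun q => (G q)⁻¹ m s) p + pd s (fun q => (G q)⁻¹ m k) p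
      - pd m (fun q => (G q)⁻¹ k s) p) * X k
  have h : conn G p X = G p * L := by
    ext a s
    simp only [conn, christoffel, L, Matrix.of_apply, Matrix.mul_apply, Finset.mul_sum,
      Finset.sum_mul]
    rw [Finset.sum_comm]
    exact Finset.sum_congr rfl fun m _ => Finset.sum_congr rfl fun k _ => by ring
  rw [h, ← Matrix.mul_assoc, hG.inv_mul hp, Matrix.one_mul]
  rfl

theorem fderiv_inv (hU : IsOpen U) (hG : IsMetric U G) (hp : p ∈ U) (X : V n) :
    fderiv ℝ (fun q => (G q)⁻¹) p X
      = (G p)⁻¹ * conn G p X + ((G p)⁻¹ * conn G p X)ᵀ := by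
  ext i j
  rw [Matrix.add_apply, Matrix.transpose_apply, hG.inv_mul_conn_apply hp,
    hG.inv_mul_conn_apply hp, ← fderiv_matrix_apply
    (differentiableAt_of_contDiffOn hU hG.contDiffOn_inv hp), fderiv_eq_grad_dotProduct,
    dotProduct, ← Finset.sum_add_distrib]
  have h (k i j : Fin n) : pd k (fun q => (G q)⁻¹ i j) p = pd k (fun q => (G q)⁻¹ j i) p := by
    simp only [pd, fderiv_eq_of_eqOn hU hp fun _ hq => (hG.isSymm_inv hq).apply j i]
  refine Finset.sum_congr rfl fun k _ => ?_
  rw [h k j i, h j k i, h i k j, grad]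
  ring

theorem fderiv_eq (hU : IsOpen U) (hG : IsMetric U G) (hp : p ∈ U) (X : V n) :
    fderiv ℝ G p X = -(conn G p X * G p + G p * (conn G p X)ᵀ) := by
  have h := fderiv_matrix_mul (differentiableAt_of_contDiffOn hU hG.contDiffOn hp)
    (differentiableAt_of_contDiffOn hU hG.contDiffOn_inv hp) X
  have hconst : fderiv ℝ (fun q => G q * (G q)⁻¹) p = 0 :=
    (fderiv_eq_of_eqOn hU hp fun q hq => hG.mul_inv hq).trans (fderiv_const_apply 1)
  rw [hconst, hG.fderiv_inv hU hp] at h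
  have h' := congrArg (· * G p) h
  simp only [zero_apply, Matrix.zero_mul,
    Matrix.add_mul, Matrix.mul_add, Matrix.mul_assoc, hG.inv_mul hp, Matrix.mul_one,
    Matrix.transpose_mul, (hG.isSymm_inv hp).eq] at h'
  rw [← Matrix.mul_assoc (G p) (G p)⁻¹, hG.mul_inv hp, Matrix.one_mul] at h'
  exact (neg_eq_of_add_eq_zero_right h'.symm).symm

theorem fderiv_conn_apply (hU : IsOpen U) (hG : IsMetric U G) (hp : p ∈ U) (X Y : V n)
    (i j : Fin n) : fderiv ℝ (fun q => conn G q Y) p X i j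
      = ∑ k, ∑ l, pd k (fun q => christoffel G q i l j) p * X k * Y l := by
  have hd (l : Fin n) := differentiableAt_of_contDiffOn hU (hG.contDiffOn_christoffel hU i l j) hp
  rw [← fderiv_matrix_apply (differentiableAt_of_contDiffOn hU (hG.contDiffOn_conn hU Y) hp)]
  simp only [conn, Matrix.of_apply]
  rw [fderiv_fun_sum fun l _ => (hd l).mul_const (Y l), Finset.sum_comm]
  simp only [fderiv_mul_const (hd _), fderiv_eq_grad_dotProduct, sum_apply,
    smul_apply, dotProduct, grad, smul_eq_mul, Finset.mul_sum]
  exact Finset.sum_congr rfl fun l _ => Finset.sum_congr rfl fun k _ => by ring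

theorem curvOp_apply (hU : IsOpen U) (hG : IsMetric U G) (hp : p ∈ U) (X Y : V n) (i j : Fin n) :
    curvOp G p X Y i j = ∑ k, ∑ l, riemann G p i j k l * X k * Y l := by
  have hmul (X Y : V n) : (conn G p X * conn G p Y) i j
      = ∑ k, ∑ l, (∑ m, christoffel G p i k m * christoffel G p m l j) * X k * Y l := by
    simp only [conn, Matrix.mul_apply, Matrix.of_apply, Finset.sum_mul_sum]
    rw [Finset.sum_comm]
    refine Finset.sum_congr rfl fun k _ => ?_
    rw [Finset.sum_comm]
    simp only [Finset.sum_mul]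
    exact Finset.sum_congr rfl fun l _ => Finset.sum_congr rfl fun m _ => by ring
  simp only [curvOp, Matrix.sub_apply, Matrix.add_apply, hG.fderiv_conn_apply hU hp, hmul]
  rw [Finset.sum_comm (f := fun k l => pd k _ p * Y k * X l),
    Finset.sum_comm (f := fun k l => _ * Y k * X l)]
  simp only [← Finset.sum_sub_distrib, ← Finset.sum_add_distrib]
  refine Finset.sum_congr rfl fun k _ => Finset.sum_congr rfl fun l _ => ?_
  rw [riemann, Finset.sum_sub_distrib]
  ring

theorem curvOp_single (hU : IsOpen U) (hG : IsMetric U G) (hp : p ∈ U) (i j k l : Fin n) :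
    curvOp G p (Pi.single k 1) (Pi.single l 1) i j = riemann G p i j k l := by
  simp [hG.curvOp_apply hU hp, Pi.single_apply]

theorem curvOp_eq_zero (hU : IsOpen U) (hG : IsMetric U G) (hflat : IsFlat U G) (hp : p ∈ U)
    (X Y : V n) : curvOp G p X Y = 0 := by
  ext i j
  simp [hG.curvOp_apply hU hp, hflat p hp]

end IsMetric

theorem isCodazzi_one (hU : IsOpen U) (hG : IsMetric U G) : IsCodazzi U G fun _ => 1 :=
  fun p hp X Y => by simpa using hG.conn_mulVec_comm hU hp X Y

end LeviCivita

section DotProduct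

variable {m n : Type*} [Fintype m] [Fintype n] {R : Type*} [CommSemiring R]

theorem transpose_mulVec_dotProduct (M : Matrix m n R) (a : m → R) (b : n → R) :
    Mᵀ *ᵥ a ⬝ᵥ b = a ⬝ᵥ M *ᵥ b := by
  rw [dotProduct_comm, Matrix.dotProduct_transpose_mulVec]

theorem mulVec_dotProduct_of_isSymm {M : Matrix n n R} (hM : M.IsSymm) (a b : n → R) :
    M *ᵥ a ⬝ᵥ b = a ⬝ᵥ M *ᵥ b := by
  rw [← transpose_mulVec_dotProduct, hM]

end DotProduct

section Hessian

variable {n : ℕ} {U : Set (V n)} {G : V n → Matrix (Fin n) (Fin n) ℝ} {p : V n} {f g : V n → ℝ}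

/-- The covariant Hessian `∇_s ∇_j f`. -/
def covHess (G : V n → Matrix (Fin n) (Fin n) ℝ) (f : V n → ℝ) (p : V n) :
    Matrix (Fin n) (Fin n) ℝ :=
  .of fun s j => pd s (fun q => pd j f q) p - ∑ k, christoffel G p k s j * pd k f p

/-- The inner product `g^{ij} ∂_i f ∂_j g` of two differentials. -/
def gradInner (G : V n → Matrix (Fin n) (Fin n) ℝ) (f g : V n → ℝ) (p : V n) : ℝ :=
  grad f p ⬝ᵥ G p *ᵥ grad g p

theorem hess_eq_mul_covHess (G : V n → Matrix (Fin n) (Fin n) ℝ) (f : V n → ℝ) (p : V n) :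
    hess G f p = G p * covHess G f p := rfl

theorem gradSq_eq_gradInner (G : V n → Matrix (Fin n) (Fin n) ℝ) (f : V n → ℝ) (p : V n) :
    gradSq G f p = gradInner G f f p := by
  simp only [gradSq, gradInner, grad, dotProduct, Matrix.mulVec, Finset.mul_sum]
  exact Finset.sum_congr rfl fun i _ => Finset.sum_congr rfl fun j _ => by ring

namespace IsMetric

theorem covHess_mulVec (hU : IsOpen U) (hG : IsMetric U G) (hf : ContDiffOn ℝ ∞ f U) (hp : p ∈ U)
    (X : V n) :
    covHess G f p *ᵥ X = fderiv ℝ (grad f) p X - (conn G p X)ᵀ *ᵥ grad f p := by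
  ext s
  have hsymm : fderiv ℝ (grad f) p X s = ∑ j, pd s (fun q => pd j f q) p * X j := by
    have hd := differentiableAt_of_contDiffOn hU (contDiffOn_grad hU hf) hp
    have h := fderiv_grad_dotProduct_comm hU hf hp X (Pi.single s 1)
    rw [dotProduct_single_one] at h
    rw [h]
    refine Finset.sum_congr rfl fun j _ => congrArg (· * X j) ?_
    exact (congrArg (· (Pi.single s 1)) (hasFDerivAt_pi'.1 hd.hasFDerivAt j).fderiv).symm
  simp only [Pi.sub_apply, hsymm, conn, covHess, Matrix.mulVec, dotProduct, Matrix.transpose_apply,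
    Matrix.of_apply, grad, sub_mul, Finset.sum_sub_distrib, Finset.sum_mul]
  rw [Finset.sum_comm (f := fun j k => christoffel G p k s j * pd k f p * X j)]
  refine congrArg _ (Finset.sum_congr rfl fun k _ => Finset.sum_congr rfl fun j _ => ?_)
  rw [hG.christoffel_symm hU hp]
  ring

theorem isSymm_covHess (hU : IsOpen U) (hG : IsMetric U G) (hf : ContDiffOn ℝ ∞ f U) (hp : p ∈ U) :
    (covHess G f p).IsSymm := by
  refine Matrix.IsSymm.ext fun s j => ?_
  simp only [covHess, Matrix.of_apply, hG.christoffel_symm hU hp _ s j, pd]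
  rw [fderiv_fderiv_apply_comm hU hf hp]

theorem contDiffOn_covHess (hU : IsOpen U) (hG : IsMetric U G) (hf : ContDiffOn ℝ ∞ f U) :
    ContDiffOn ℝ ∞ (covHess G f) U := by
  have hΓ := hG.contDiffOn_christoffel hU
  have hpd (k : Fin n) := contDiffOn_pi.1 (contDiffOn_grad hU hf) k
  have hpd' (j k : Fin n) : ContDiffOn ℝ ∞ (fun q => pd j (fun r => pd k f r) q) U :=
    contDiffOn_fderiv_apply hU (hpd k) (Pi.single j 1)
  refine contDiffOn_matrix.2 fun i j => ?_
  simp only [covHess, Matrix.of_apply]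
  simp only [grad] at hpd
  fun_prop

theorem contDiffOn_hess (hU : IsOpen U) (hG : IsMetric U G) (hf : ContDiffOn ℝ ∞ f U) :
    ContDiffOn ℝ ∞ (hess G f) U :=
  contDiffOn_matrix_mul hG.contDiffOn (hG.contDiffOn_covHess hU hf)

theorem contDiffOn_gradInner (hU : IsOpen U) (hG : IsMetric U G) (hf : ContDiffOn ℝ ∞ f U)
    (hg : ContDiffOn ℝ ∞ g U) : ContDiffOn ℝ ∞ (gradInner G f g) U :=
  contDiffOn_dotProduct (contDiffOn_grad hU hf)
    (contDiffOn_mulVec hG.contDiffOn (contDiffOn_grad hU hg))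

theorem fderiv_mulVec_covector (hU : IsOpen U) (hG : IsMetric U G) (hp : p ∈ U) {θ : V n → V n}
    (hθ : DifferentiableAt ℝ θ p) (X : V n) :
    fderiv ℝ (fun q => G q *ᵥ θ q) p X
      = G p *ᵥ (fderiv ℝ θ p X - (conn G p X)ᵀ *ᵥ θ p) - conn G p X *ᵥ G p *ᵥ θ p := by
  rw [fderiv_mulVec (differentiableAt_of_contDiffOn hU hG.contDiffOn hp) hθ, hG.fderiv_eq hU hp]
  simp only [Matrix.neg_mulVec, Matrix.add_mulVec, Matrix.mulVec_sub, Matrix.mulVec_mulVec]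
  abel

theorem fderiv_gradInner (hU : IsOpen U) (hG : IsMetric U G) (hf : ContDiffOn ℝ ∞ f U)
    (hg : ContDiffOn ℝ ∞ g U) (hp : p ∈ U) (X : V n) :
    fderiv ℝ (gradInner G f g) p X
      = grad f p ⬝ᵥ hess G g p *ᵥ X + grad g p ⬝ᵥ hess G f p *ᵥ X := by
  have hdf := differentiableAt_of_contDiffOn hU (contDiffOn_grad hU hf) hp
  have hdg := differentiableAt_of_contDiffOn hU (contDiffOn_grad hU hg) hp
  have hdGg := differentiableAt_of_contDiffOn hU
    (contDiffOn_mulVec hG.contDiffOn (contDiffOn_grad hU hg)) hp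
  have hHf : fderiv ℝ (grad f) p X = covHess G f p *ᵥ X + (conn G p X)ᵀ *ᵥ grad f p := by
    rw [hG.covHess_mulVec hU hf hp, sub_add_cancel]
  unfold gradInner
  rw [fderiv_dotProduct hdf hdGg, hG.fderiv_mulVec_covector hU hp hdg,
    ← hG.covHess_mulVec hU hg hp, hHf, add_dotProduct, transpose_mulVec_dotProduct,
    dotProduct_comm (covHess G f p *ᵥ X), mulVec_dotProduct_of_isSymm (hG.isSymm hp),
    dotProduct_sub]
  simp only [hess_eq_mul_covHess, ← Matrix.mulVec_mulVec]
  ring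

theorem ricci_identity (hU : IsOpen U) (hG : IsMetric U G) (hf : ContDiffOn ℝ ∞ f U) (hp : p ∈ U)
    (X Y : V n) :
    fderiv ℝ (fun q => covHess G f q *ᵥ Y) p X - (conn G p X)ᵀ *ᵥ covHess G f p *ᵥ Y
      = fderiv ℝ (fun q => covHess G f q *ᵥ X) p Y - (conn G p Y)ᵀ *ᵥ covHess G f p *ᵥ X
        - (curvOp G p X Y)ᵀ *ᵥ grad f p := by
  have hdf := contDiffOn_grad hU hf
  have hΓ (Y : V n) := contDiffOn_transpose (hG.contDiffOn_conn hU Y)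
  have hderiv (X Y : V n) : fderiv ℝ (fun q => covHess G f q *ᵥ Y) p X
      = fderiv ℝ (fun q => fderiv ℝ (grad f) q Y) p X
        - ((conn G p Y)ᵀ *ᵥ fderiv ℝ (grad f) p X
          + (fderiv ℝ (fun q => conn G q Y) p X)ᵀ *ᵥ grad f p) := by
    rw [fderiv_eq_of_eqOn hU hp fun q hq => hG.covHess_mulVec hU hf hq Y,
      fderiv_fun_sub (differentiableAt_of_contDiffOn hU (contDiffOn_fderiv_apply hU hdf Y) hp)
        (differentiableAt_of_contDiffOn hU (contDiffOn_mulVec (hΓ Y) hdf) hp), sub_apply,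
      fderiv_mulVec (differentiableAt_of_contDiffOn hU (hΓ Y) hp)
        (differentiableAt_of_contDiffOn hU hdf hp),
      fderiv_transpose (differentiableAt_of_contDiffOn hU (hG.contDiffOn_conn hU Y) hp)]
  rw [hderiv, hderiv, fderiv_fderiv_apply_comm hU hdf hp, hG.covHess_mulVec hU hf hp,
    hG.covHess_mulVec hU hf hp, curvOp]
  simp only [Matrix.transpose_add, Matrix.transpose_sub, Matrix.transpose_mul, Matrix.add_mulVec,
    Matrix.sub_mulVec, Matrix.mulVec_sub, Matrix.mulVec_mulVec]
  abel

theorem isCodazzi_hess (hU : IsOpen U) (hG : IsMetric U G) (hflat : IsFlat U G)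
    (hf : ContDiffOn ℝ ∞ f U) : IsCodazzi U G (hess G f) := by
  intro p hp X Y
  have hH (Y : V n) : DifferentiableAt ℝ (fun q => covHess G f q *ᵥ Y) p :=
    differentiableAt_of_contDiffOn hU
      (contDiffOn_mulVec (hG.contDiffOn_covHess hU hf) contDiffOn_const) hp
  have hderiv (X Y : V n) : fderiv ℝ (hess G f) p X *ᵥ Y + conn G p X *ᵥ hess G f p *ᵥ Y
      = G p *ᵥ (fderiv ℝ (fun q => covHess G f q *ᵥ Y) p X
        - (conn G p X)ᵀ *ᵥ covHess G f p *ᵥ Y) := by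
    rw [← fderiv_mulVec_const (differentiableAt_of_contDiffOn hU (hG.contDiffOn_hess hU hf) hp)]
    simp only [hess_eq_mul_covHess, ← Matrix.mulVec_mulVec]
    rw [hG.fderiv_mulVec_covector hU hp (hH Y), sub_add_cancel]
  rw [hderiv, hderiv, hG.ricci_identity hU hf hp, hG.curvOp_eq_zero hU hflat hp,
    Matrix.transpose_zero, Matrix.zero_mulVec, sub_zero]

end IsMetric

end Hessian

section ConformalChange

variable {n : ℕ} {U : Set (V n)} {G : V n → Matrix (Fin n) (Fin n) ℝ} {B f : V n → ℝ} {p : V n}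

/-- The difference `Γ(X) - Γ̃(X)` of the connection matrices of `g` and `B² g`. -/
def conformalShift (G : V n → Matrix (Fin n) (Fin n) ℝ) (B : V n → ℝ) (p X : V n) :
    Matrix (Fin n) (Fin n) ℝ :=
  (B p)⁻¹ • ((grad B p ⬝ᵥ X) • 1 + Matrix.vecMulVec X (grad B p)
    - Matrix.vecMulVec (G p *ᵥ grad B p) ((G p)⁻¹ *ᵥ X))

theorem conformalShift_mulVec (G : V n → Matrix (Fin n) (Fin n) ℝ) (B : V n → ℝ) (p X Z : V n) :
    conformalShift G B p X *ᵥ Z = (B p)⁻¹ • ((grad B p ⬝ᵥ X) • Z + (grad B p ⬝ᵥ Z) • X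
      - ((G p)⁻¹ *ᵥ X ⬝ᵥ Z) • G p *ᵥ grad B p) := by
  simp only [conformalShift, Matrix.smul_mulVec, Matrix.sub_mulVec, Matrix.add_mulVec,
    Matrix.one_mulVec, Matrix.vecMulVec_mulVec, op_smul_eq_smul]

theorem isMetric_newMetric (hG : IsMetric U G) (hB : ContDiffOn ℝ ∞ B U)
    (hB0 : ∀ q ∈ U, B q ≠ 0) : IsMetric U (newMetric G B) where
  smooth i j := (hB.pow 2).mul (hG.smooth i j)
  symm p hp i j := congrArg (B p ^ 2 * ·) (hG.symm p hp i j)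
  nondeg p hp := by simp [newMetric, hB0 p hp, hG.nondeg p hp]

theorem newMetric_inv (hG : IsMetric U G) (hB0 : ∀ q ∈ U, B q ≠ 0) (hp : p ∈ U) :
    (newMetric G B p)⁻¹ = ((B p) ^ 2)⁻¹ • (G p)⁻¹ :=
  Matrix.inv_eq_left_inv <| by
    rw [newMetric, Matrix.smul_mul, Matrix.mul_smul, hG.inv_mul hp,
      inv_smul_smul₀ (pow_ne_zero 2 (hB0 p hp))]

theorem fderiv_inv_sq (hd : DifferentiableAt ℝ B p) (hB : B p ≠ 0) (X : V n) :
    fderiv ℝ (fun q => ((B q) ^ 2)⁻¹) p X = -(2 * ((B p) ^ 3)⁻¹ * (grad B p ⬝ᵥ X)) := by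
  have h := ((hasDerivAt_inv (pow_ne_zero 2 hB)).comp_hasFDerivAt p (hd.hasFDerivAt.pow 2)).fderiv
  rw [Function.comp_def] at h
  simp only [h, smul_apply, fderiv_eq_grad_dotProduct, smul_eq_mul, nsmul_eq_mul]
  field_simp
  ring

namespace IsMetric

-- The difference of the two connections is symmetric in two and antisymmetric in the other two of
-- its three lowered indices, so it vanishes.
theorem conn_eq_of_fderiv_inv (hU : IsOpen U) (hG : IsMetric U G) (hp : p ∈ U)
    {C : V n → Matrix (Fin n) (Fin n) ℝ} (hsymm : ∀ X Y, C X *ᵥ Y = C Y *ᵥ X)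
    (hcompat : ∀ X, fderiv ℝ (fun q => (G q)⁻¹) p X = (G p)⁻¹ * C X + ((G p)⁻¹ * C X)ᵀ) (X : V n) :
    conn G p X = C X := by
  set K : V n → Matrix (Fin n) (Fin n) ℝ := fun X => (G p)⁻¹ * (conn G p X - C X) with hK
  have hskew (X : V n) : (K X)ᵀ = -K X := by
    have h := (hG.fderiv_inv hU hp X).symm.trans (hcompat X)
    simp only [hK, Matrix.mul_sub, Matrix.transpose_sub]
    rw [← sub_eq_zero] at h ⊢
    rw [← h]
    abel
  have hswap (X Y Z : V n) : Z ⬝ᵥ K X *ᵥ Y = Z ⬝ᵥ K Y *ᵥ X := by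
    simp only [hK, ← Matrix.mulVec_mulVec, Matrix.sub_mulVec, hG.conn_mulVec_comm hU hp X Y,
      hsymm X Y]
  have hneg (X Y Z : V n) : Z ⬝ᵥ K X *ᵥ Y = -(Y ⬝ᵥ K X *ᵥ Z) := by
    rw [← transpose_mulVec_dotProduct, hskew, Matrix.neg_mulVec, neg_dotProduct, dotProduct_comm]
  have hzero (X Y Z : V n) : Z ⬝ᵥ K X *ᵥ Y = 0 := by
    linarith [hneg X Y Z, hswap X Z Y, hneg Z X Y, hswap Z Y X, hneg Y Z X, hswap Y X Z]
  have hK0 : K X = 0 := by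
    refine Matrix.mulVec_injective (funext fun Y => ?_)
    rw [Matrix.zero_mulVec]
    exact dotProduct_eq_zero _ fun Z => by rw [dotProduct_comm, hzero]
  have h := congrArg (G p * ·) hK0
  simp only [hK, ← Matrix.mul_assoc, hG.mul_inv hp, Matrix.one_mul, Matrix.mul_zero] at h
  exact sub_eq_zero.1 h

theorem conformalShift_mulVec_comm (hG : IsMetric U G) (hp : p ∈ U) (B : V n → ℝ) (X Y : V n) :
    conformalShift G B p X *ᵥ Y = conformalShift G B p Y *ᵥ X := by
  rw [conformalShift_mulVec, conformalShift_mulVec, mulVec_dotProduct_of_isSymm (hG.isSymm_inv hp),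
    dotProduct_comm X]
  module

theorem inv_mul_conformalShift_add_transpose (hG : IsMetric U G) (hp : p ∈ U) (B : V n → ℝ)
    (X : V n) : (G p)⁻¹ * conformalShift G B p X + ((G p)⁻¹ * conformalShift G B p X)ᵀ
      = (2 * (B p)⁻¹ * (grad B p ⬝ᵥ X)) • (G p)⁻¹ := by
  simp only [conformalShift, Matrix.mul_smul, Matrix.mul_sub, Matrix.mul_add, Matrix.mul_one,
    Matrix.mul_vecMulVec, Matrix.mulVec_mulVec, hG.inv_mul hp, Matrix.one_mulVec,
    Matrix.transpose_smul, Matrix.transpose_sub, Matrix.transpose_add, Matrix.transpose_vecMulVec,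
    (hG.isSymm_inv hp).eq]
  module

end IsMetric

theorem conn_newMetric (hU : IsOpen U) (hG : IsMetric U G) (hB : ContDiffOn ℝ ∞ B U)
    (hB0 : ∀ q ∈ U, B q ≠ 0) (hp : p ∈ U) (X : V n) :
    conn (newMetric G B) p X = conn G p X - conformalShift G B p X := by
  refine (isMetric_newMetric hG hB hB0).conn_eq_of_fderiv_inv hU hp
    (C := fun X => conn G p X - conformalShift G B p X) (fun X Y => ?_) (fun X => ?_) X
  · rw [Matrix.sub_mulVec, Matrix.sub_mulVec, hG.conn_mulVec_comm hU hp,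
      hG.conformalShift_mulVec_comm hp]
  · have hBd := differentiableAt_of_contDiffOn hU hB hp
    have hBp := hB0 p hp
    have hinv : fderiv ℝ (fun q => (newMetric G B q)⁻¹) p X
        = fderiv ℝ (fun q => ((B q) ^ 2)⁻¹ • (G q)⁻¹) p X :=
      congrArg (· X) (fderiv_eq_of_eqOn hU hp fun q hq => newMetric_inv hG hB0 hq)
    have hT : ((G p)⁻¹ * conformalShift G B p X)ᵀ = (2 * (B p)⁻¹ * (grad B p ⬝ᵥ X)) • (G p)⁻¹
        - (G p)⁻¹ * conformalShift G B p X :=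
      eq_sub_of_add_eq' (hG.inv_mul_conformalShift_add_transpose hp B X)
    rw [hinv, fderiv_matrix_smul (B := fun q => ((B q) ^ 2)⁻¹)
      ((hBd.pow 2).inv (pow_ne_zero 2 hBp))
      (differentiableAt_of_contDiffOn hU hG.contDiffOn_inv hp), fderiv_inv_sq hBd hBp,
      hG.fderiv_inv hU hp, newMetric_inv hG hB0 hp]
    simp only [Matrix.smul_mul, Matrix.mul_sub, Matrix.transpose_smul, Matrix.transpose_sub, hT]
    have h3 : ((B p) ^ 3)⁻¹ = ((B p) ^ 2)⁻¹ * (B p)⁻¹ := by field_simp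
    rw [h3]
    module

namespace IsMetric

theorem fderiv_grad_dotProduct (hU : IsOpen U) (hG : IsMetric U G) (hf : ContDiffOn ℝ ∞ f U)
    (hp : p ∈ U) (X Y : V n) : fderiv ℝ (fun q => grad f q ⬝ᵥ Y) p X
      = covHess G f p *ᵥ X ⬝ᵥ Y + grad f p ⬝ᵥ conn G p X *ᵥ Y := by
  rw [fderiv_dotProduct (differentiableAt_of_contDiffOn hU (contDiffOn_grad hU hf) hp)
    (differentiableAt_const Y), hG.covHess_mulVec hU hf hp, sub_dotProduct,
    transpose_mulVec_dotProduct]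
  simp

theorem fderiv_inv_mulVec_dotProduct (hU : IsOpen U) (hG : IsMetric U G) (hp : p ∈ U)
    (X Y Z : V n) : fderiv ℝ (fun q => (G q)⁻¹ *ᵥ Y ⬝ᵥ Z) p X
      = (G p)⁻¹ *ᵥ conn G p X *ᵥ Y ⬝ᵥ Z + (G p)⁻¹ *ᵥ Y ⬝ᵥ conn G p X *ᵥ Z := by
  have hd := differentiableAt_of_contDiffOn hU hG.contDiffOn_inv hp
  rw [fderiv_dotProduct (differentiableAt_of_contDiffOn hU
    (contDiffOn_mulVec hG.contDiffOn_inv contDiffOn_const) hp) (differentiableAt_const Z),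
    fderiv_mulVec_const hd, hG.fderiv_inv hU hp, Matrix.add_mulVec, add_dotProduct,
    transpose_mulVec_dotProduct]
  simp [mulVec_dotProduct_of_isSymm (hG.isSymm_inv hp) Y]

end IsMetric

theorem contDiffOn_conformalShift_mulVec (hU : IsOpen U) (hG : IsMetric U G)
    (hB : ContDiffOn ℝ ∞ B U) (hB0 : ∀ q ∈ U, B q ≠ 0) (Y Z : V n) :
    ContDiffOn ℝ ∞ (fun q => conformalShift G B q Y *ᵥ Z) U := by
  have hgradB := contDiffOn_grad hU hB
  have hinv := hG.contDiffOn_inv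
  have hGs := hG.contDiffOn
  simp only [conformalShift_mulVec]
  fun_prop (disch := assumption)

theorem smul_fderiv_conformalShift (hU : IsOpen U) (hG : IsMetric U G) (hB : ContDiffOn ℝ ∞ B U)
    (hB0 : ∀ q ∈ U, B q ≠ 0) (hp : p ∈ U) (X Y Z : V n) :
    B p • (fderiv ℝ (fun q => conformalShift G B q Y *ᵥ Z) p X
        + conn G p X *ᵥ conformalShift G B p Y *ᵥ Z - conformalShift G B p Y *ᵥ conn G p X *ᵥ Z)
      = B p • conformalShift G B p (conn G p X *ᵥ Y) *ᵥ Z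
        - (grad B p ⬝ᵥ X) • conformalShift G B p Y *ᵥ Z
        + ((covHess G B p *ᵥ X ⬝ᵥ Y) • Z + (covHess G B p *ᵥ X ⬝ᵥ Z) • Y
          - ((G p)⁻¹ *ᵥ Y ⬝ᵥ Z) • hess G B p *ᵥ X) := by
  have hgradB := contDiffOn_grad hU hB
  have hinv := hG.contDiffOn_inv
  have hGs := hG.contDiffOn
  have hdot (Y : V n) : DifferentiableAt ℝ (fun q => grad B q ⬝ᵥ Y) p :=
    differentiableAt_of_contDiffOn hU (by fun_prop) hp
  have hgY : DifferentiableAt ℝ (fun q => (G q)⁻¹ *ᵥ Y ⬝ᵥ Z) p :=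
    differentiableAt_of_contDiffOn hU (by fun_prop) hp
  have hb : DifferentiableAt ℝ (fun q => G q *ᵥ grad B q) p :=
    differentiableAt_of_contDiffOn hU (by fun_prop) hp
  have hsmul (q) (hq : q ∈ U) (X Z : V n) : B q • conformalShift G B q X *ᵥ Z
      = (grad B q ⬝ᵥ X) • Z + (grad B q ⬝ᵥ Z) • X
        - ((G q)⁻¹ *ᵥ X ⬝ᵥ Z) • G q *ᵥ grad B q := by
    rw [conformalShift_mulVec, smul_inv_smul₀ (hB0 q hq)]
  have h := congrArg (· X) (fderiv_eq_of_eqOn hU hp fun q hq => hsmul q hq Y Z)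
  rw [fderiv_fun_smul (differentiableAt_of_contDiffOn hU hB hp)
    (differentiableAt_of_contDiffOn hU (contDiffOn_conformalShift_mulVec hU hG hB hB0 Y Z) hp),
    fderiv_fun_sub (((hdot Y).smul_const Z).fun_add ((hdot Z).smul_const Y)) (hgY.fun_smul hb),
    fderiv_fun_add ((hdot Y).smul_const Z) ((hdot Z).smul_const Y), fderiv_smul_const (hdot Y),
    fderiv_smul_const (hdot Z), fderiv_fun_smul hgY hb] at h
  simp only [add_apply, sub_apply, smul_apply, ContinuousLinearMap.smulRight_apply,
    hG.fderiv_grad_dotProduct hU hB hp, hG.fderiv_inv_mulVec_dotProduct hU hp,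
    hG.fderiv_mulVec_covector hU hp (differentiableAt_of_contDiffOn hU hgradB hp),
    ← hG.covHess_mulVec hU hB hp, Matrix.mulVec_mulVec, ← hess_eq_mul_covHess,
    fderiv_eq_grad_dotProduct B] at h
  have hΓ : B p • conn G p X *ᵥ conformalShift G B p Y *ᵥ Z = (grad B p ⬝ᵥ Y) • conn G p X *ᵥ Z
      + (grad B p ⬝ᵥ Z) • conn G p X *ᵥ Y
      - ((G p)⁻¹ *ᵥ Y ⬝ᵥ Z) • conn G p X *ᵥ G p *ᵥ grad B p := by
    rw [← Matrix.mulVec_smul, hsmul p hp]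
    simp only [Matrix.mulVec_add, Matrix.mulVec_sub, Matrix.mulVec_smul]
  rw [smul_sub, smul_add, hΓ, hsmul p hp, hsmul p hp, eq_sub_of_add_eq h]
  simp only [Matrix.mulVec_mulVec]
  module

theorem commutator_conformalShift (hG : IsMetric U G) (hp : p ∈ U) (hB0 : B p ≠ 0) (X Y Z : V n) :
    B p ^ 2 • (conformalShift G B p X *ᵥ conformalShift G B p Y *ᵥ Z
        - conformalShift G B p Y *ᵥ conformalShift G B p X *ᵥ Z)
      = (grad B p ⬝ᵥ Z) • ((grad B p ⬝ᵥ Y) • X - (grad B p ⬝ᵥ X) • Y)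
        - gradSq G B p • (((G p)⁻¹ *ᵥ Y ⬝ᵥ Z) • X - ((G p)⁻¹ *ᵥ X ⬝ᵥ Z) • Y)
        + ((grad B p ⬝ᵥ X) * ((G p)⁻¹ *ᵥ Y ⬝ᵥ Z)
          - (grad B p ⬝ᵥ Y) * ((G p)⁻¹ *ᵥ X ⬝ᵥ Z)) • G p *ᵥ grad B p := by
  have hlow (X : V n) : (G p)⁻¹ *ᵥ X ⬝ᵥ G p *ᵥ grad B p = grad B p ⬝ᵥ X := by
    rw [dotProduct_comm, mulVec_dotProduct_of_isSymm (hG.isSymm hp), Matrix.mulVec_mulVec,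
      hG.mul_inv hp, Matrix.one_mulVec]
  have hXY : (G p)⁻¹ *ᵥ Y ⬝ᵥ X = (G p)⁻¹ *ᵥ X ⬝ᵥ Y := by
    rw [mulVec_dotProduct_of_isSymm (hG.isSymm_inv hp), dotProduct_comm]
  simp only [conformalShift_mulVec, dotProduct_smul, dotProduct_add, dotProduct_sub, hlow, hXY,
    smul_eq_mul, gradSq_eq_gradInner, gradInner]
  match_scalars <;> field_simp <;> ring

theorem hess_newMetric_mulVec (hU : IsOpen U) (hG : IsMetric U G) (hB : ContDiffOn ℝ ∞ B U)
    (hB0 : ∀ q ∈ U, B q ≠ 0) (hf : ContDiffOn ℝ ∞ f U) (hp : p ∈ U) (X : V n) :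
    hess (newMetric G B) f p *ᵥ X = B p ^ 2 • hess G f p *ᵥ X
      + B p • ((grad B p ⬝ᵥ X) • G p *ᵥ grad f p + (grad f p ⬝ᵥ X) • G p *ᵥ grad B p
        - gradInner G B f p • X) := by
  have hshift : (conformalShift G B p X)ᵀ *ᵥ grad f p = (B p)⁻¹ • ((grad B p ⬝ᵥ X) • grad f p
      + (grad f p ⬝ᵥ X) • grad B p - gradInner G B f p • (G p)⁻¹ *ᵥ X) := by
    simp only [conformalShift, Matrix.transpose_smul, Matrix.transpose_sub, Matrix.transpose_add,
      Matrix.transpose_one, Matrix.transpose_vecMulVec, Matrix.smul_mulVec, Matrix.sub_mulVec,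
      Matrix.add_mulVec, Matrix.one_mulVec, Matrix.vecMulVec_mulVec, op_smul_eq_smul,
      mulVec_dotProduct_of_isSymm (hG.isSymm hp), gradInner, dotProduct_comm X]
  have hcov : covHess (newMetric G B) f p *ᵥ X = covHess G f p *ᵥ X
      + (conformalShift G B p X)ᵀ *ᵥ grad f p := by
    rw [(isMetric_newMetric hG hB hB0).covHess_mulVec hU hf hp, hG.covHess_mulVec hU hf hp,
      conn_newMetric hU hG hB hB0 hp, Matrix.transpose_sub, Matrix.sub_mulVec]
    abel
  have hBB : B p ^ 2 * (B p)⁻¹ = B p := by have := hB0 p hp; field_simp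
  rw [hess_eq_mul_covHess, ← Matrix.mulVec_mulVec, hcov, hshift, newMetric, Matrix.smul_mulVec,
    Matrix.mulVec_add, Matrix.mulVec_smul, smul_add, smul_smul _ (B p)⁻¹, hBB]
  simp only [Matrix.mulVec_sub, Matrix.mulVec_add, Matrix.mulVec_smul, Matrix.mulVec_mulVec,
    hG.mul_inv hp, Matrix.one_mulVec, hess_eq_mul_covHess]

theorem IsMetric.curvOp_mulVec (hU : IsOpen U) (hG : IsMetric U G) (hp : p ∈ U) (X Y Z : V n) :
    curvOp G p X Y *ᵥ Z
      = fderiv ℝ (fun q => conn G q Y *ᵥ Z) p X - fderiv ℝ (fun q => conn G q X *ᵥ Z) p Y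
        + (conn G p X *ᵥ conn G p Y *ᵥ Z - conn G p Y *ᵥ conn G p X *ᵥ Z) := by
  have hd (Y : V n) := differentiableAt_of_contDiffOn hU (hG.contDiffOn_conn hU Y) hp
  rw [fderiv_mulVec_const (hd Y), fderiv_mulVec_const (hd X), curvOp]
  simp only [Matrix.add_mulVec, Matrix.sub_mulVec, Matrix.mulVec_mulVec]

theorem newTail_mulVec (G : V n → Matrix (Fin n) (Fin n) ℝ) (B : V n → ℝ) (p X : V n) :
    newTail G B p *ᵥ X = B p • hess G B p *ᵥ X - ((1 / 2) * gradSq G B p) • X := by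
  rw [newTail, Matrix.sub_mulVec, Matrix.smul_mulVec, Matrix.smul_mulVec, Matrix.one_mulVec]

theorem inv_mulVec_newTail (hG : IsMetric U G) (hp : p ∈ U) (B : V n → ℝ) (X : V n) :
    (G p)⁻¹ *ᵥ newTail G B p *ᵥ X
      = B p • covHess G B p *ᵥ X - ((1 / 2) * gradSq G B p) • (G p)⁻¹ *ᵥ X := by
  rw [newTail_mulVec, Matrix.mulVec_sub, Matrix.mulVec_smul, Matrix.mulVec_smul,
    hess_eq_mul_covHess, Matrix.mulVec_mulVec, ← Matrix.mul_assoc, hG.inv_mul hp, Matrix.one_mul]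

theorem fderiv_conn_newMetric_mulVec (hU : IsOpen U) (hG : IsMetric U G)
    (hB : ContDiffOn ℝ ∞ B U) (hB0 : ∀ q ∈ U, B q ≠ 0) (hp : p ∈ U) (Y Z : V n) :
    fderiv ℝ (fun q => conn (newMetric G B) q Y *ᵥ Z) p
    = fderiv ℝ (fun q => conn G q Y *ᵥ Z) p
      - fderiv ℝ (fun q => conformalShift G B q Y *ᵥ Z) p := by
  have h : Set.EqOn (fun q => conn (newMetric G B) q Y *ᵥ Z)
      (fun q => conn G q Y *ᵥ Z - conformalShift G B q Y *ᵥ Z) U := fun q hq => by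
    simp only [conn_newMetric hU hG hB hB0 hq, Matrix.sub_mulVec]
  have hΓ := contDiffOn_mulVec (hG.contDiffOn_conn hU Y) (contDiffOn_const (c := Z))
  rw [fderiv_eq_of_eqOn hU hp h, fderiv_fun_sub (differentiableAt_of_contDiffOn hU hΓ hp)
    (differentiableAt_of_contDiffOn hU (contDiffOn_conformalShift_mulVec hU hG hB hB0 Y Z) hp)]

theorem smul_curvOp_newMetric (hU : IsOpen U) (hG : IsMetric U G) (hB : ContDiffOn ℝ ∞ B U)
    (hB0 : ∀ q ∈ U, B q ≠ 0) (hp : p ∈ U) (X Y Z : V n) :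
    B p ^ 2 • (curvOp (newMetric G B) p X Y *ᵥ Z - curvOp G p X Y *ᵥ Z)
      = ((G p)⁻¹ *ᵥ Y ⬝ᵥ Z) • newTail G B p *ᵥ X - ((G p)⁻¹ *ᵥ X ⬝ᵥ Z) • newTail G B p *ᵥ Y
        + ((G p)⁻¹ *ᵥ newTail G B p *ᵥ Y ⬝ᵥ Z) • X
        - ((G p)⁻¹ *ᵥ newTail G B p *ᵥ X ⬝ᵥ Z) • Y := by
  have hX := smul_fderiv_conformalShift hU hG hB hB0 hp X Y Z
  have hY := smul_fderiv_conformalShift hU hG hB hB0 hp Y X Z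
  have hXY := commutator_conformalShift hG hp (hB0 p hp) X Y Z
  have hH : covHess G B p *ᵥ Y ⬝ᵥ X = covHess G B p *ᵥ X ⬝ᵥ Y := by
    rw [mulVec_dotProduct_of_isSymm (hG.isSymm_covHess hU hB hp), dotProduct_comm]
  rw [hH, hG.conn_mulVec_comm hU hp Y X] at hY
  rw [(isMetric_newMetric hG hB hB0).curvOp_mulVec hU hp, hG.curvOp_mulVec hU hp,
    fderiv_conn_newMetric_mulVec hU hG hB hB0 hp, fderiv_conn_newMetric_mulVec hU hG hB hB0 hp]
  simp only [conn_newMetric hU hG hB hB0 hp, Matrix.sub_mulVec, Matrix.mulVec_sub, sub_apply]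
  trans B p • B p • (fderiv ℝ (fun q => conformalShift G B q X *ᵥ Z) p Y
          + conn G p Y *ᵥ conformalShift G B p X *ᵥ Z - conformalShift G B p X *ᵥ conn G p Y *ᵥ Z)
        - B p • B p • (fderiv ℝ (fun q => conformalShift G B q Y *ᵥ Z) p X
          + conn G p X *ᵥ conformalShift G B p Y *ᵥ Z - conformalShift G B p Y *ᵥ conn G p X *ᵥ Z)
        + B p ^ 2 • (conformalShift G B p X *ᵥ conformalShift G B p Y *ᵥ Z
          - conformalShift G B p Y *ᵥ conformalShift G B p X *ᵥ Z)
  · module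
  · rw [hX, hY, hXY, inv_mulVec_newTail hG hp, inv_mulVec_newTail hG hp,
      newTail_mulVec, newTail_mulVec]
    simp only [conformalShift_mulVec G B p X Z, conformalShift_mulVec G B p Y Z, sub_dotProduct,
      smul_dotProduct, smul_eq_mul]
    have := hB0 p hp
    match_scalars <;> field_simp <;> ring

end ConformalChange

section ConformalTail

variable {n : ℕ} {U : Set (V n)} {G w : V n → Matrix (Fin n) (Fin n) ℝ} {B : V n → ℝ} {p : V n}

/-- The conditions on a metric `g` and an affinor `w` that make an operator of conformally flat
type out of them: `g_{is} w^s_j` is symmetric, `∇_k w^i_j` is symmetric in `j` and `k`, and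
`R^{ij}_{kl} = w^i_k δ^j_l + w^j_l δ^i_k - w^j_k δ^i_l - w^i_l δ^j_k`. The last two conditions are
contracted with vectors. -/
structure IsConformalTail (U : Set (V n)) (G w : V n → Matrix (Fin n) (Fin n) ℝ) : Prop where
  smooth : ContDiffOn ℝ ∞ w U
  isSymm : ∀ p ∈ U, ((G p)⁻¹ * w p).IsSymm
  codazzi : IsCodazzi U G w
  curvOp_mulVec : ∀ p ∈ U, ∀ X Y Z, curvOp G p X Y *ᵥ Z
    = ((G p)⁻¹ *ᵥ Y ⬝ᵥ Z) • w p *ᵥ X - ((G p)⁻¹ *ᵥ X ⬝ᵥ Z) • w p *ᵥ Y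
      + ((G p)⁻¹ *ᵥ w p *ᵥ Y ⬝ᵥ Z) • X - ((G p)⁻¹ *ᵥ w p *ᵥ X ⬝ᵥ Z) • Y

namespace IsConformalTail

theorem covDeriv_comm (hU : IsOpen U) (hG : IsMetric U G) (hw : IsConformalTail U G w)
    (hp : p ∈ U) (i j k : Fin n) : covDeriv G w p k i j = covDeriv G w p j i k := by
  have hd := differentiableAt_of_contDiffOn hU hw.smooth hp
  have hcov (k j : Fin n) : covDeriv G w p k i j = (fderiv ℝ w p (Pi.single k 1) *ᵥ Pi.single j 1
      + conn G p (Pi.single k 1) *ᵥ w p *ᵥ Pi.single j 1) i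
        - ∑ m, christoffel G p m k j * w p i m := by
    rw [covDeriv, Finset.sum_sub_distrib, pd, fderiv_matrix_apply hd]
    simp [Matrix.mulVec, dotProduct, conn_single, Matrix.col_apply,
      add_sub_assoc]
  rw [hcov, hcov, hw.codazzi p hp]
  simp only [hG.christoffel_symm hU hp _ j k]

theorem curvature_eq (hU : IsOpen U) (hG : IsMetric U G) (hw : IsConformalTail U G w) (hp : p ∈ U)
    (i j k l : Fin n) : curvature G p i j k l
      = w p i k * (1 : Matrix (Fin n) (Fin n) ℝ) j l + w p j l * (1 : Matrix (Fin n) (Fin n) ℝ) i k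
      - w p j k * (1 : Matrix (Fin n) (Fin n) ℝ) i l
      - w p i l * (1 : Matrix (Fin n) (Fin n) ℝ) j k := by
  have hlow (Y : V n) : (G p)⁻¹ *ᵥ Y ⬝ᵥ G p *ᵥ Pi.single j 1 = Y j := by
    rw [mulVec_dotProduct_of_isSymm (hG.isSymm_inv hp), Matrix.mulVec_mulVec, hG.inv_mul hp,
      Matrix.one_mulVec, dotProduct_single_one]
  have hcurv : curvature G p i j k l
      = (curvOp G p (Pi.single k 1) (Pi.single l 1) *ᵥ G p *ᵥ Pi.single j 1) i := by
    simp only [curvature, ← hG.curvOp_single hU hp, Matrix.mulVec_single_one]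
    simp only [Matrix.mulVec, dotProduct, Matrix.col_apply, hG.symm p hp j, mul_comm]
  rw [hcurv, hw.curvOp_mulVec p hp]
  simp only [hlow]
  simp only [Matrix.mulVec_single_one, Matrix.col_apply, Pi.add_apply, Pi.sub_apply,
    Pi.smul_apply, smul_eq_mul, Pi.single_apply, Matrix.one_apply]
  ring

end IsConformalTail

theorem contDiffOn_newTail (hU : IsOpen U) (hG : IsMetric U G) (hB : ContDiffOn ℝ ∞ B U) :
    ContDiffOn ℝ ∞ (newTail G B) U := by
  have hN := hG.contDiffOn_hess hU hB
  have hσ := hG.contDiffOn_gradInner hU hB hB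
  unfold newTail
  simp only [gradSq_eq_gradInner]
  fun_prop

theorem newMetric_inv_mul_newTail (hG : IsMetric U G) (hB0 : ∀ q ∈ U, B q ≠ 0) (hp : p ∈ U) :
    (newMetric G B p)⁻¹ * newTail G B p
      = ((B p) ^ 2)⁻¹ • (B p • covHess G B p - ((1 / 2) * gradSq G B p) • (G p)⁻¹) := by
  rw [newMetric_inv hG hB0 hp, Matrix.smul_mul]
  refine congrArg _ (Matrix.mulVec_injective (funext fun X => ?_))
  rw [← Matrix.mulVec_mulVec, inv_mulVec_newTail hG hp, Matrix.sub_mulVec, Matrix.smul_mulVec,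
    Matrix.smul_mulVec]

theorem fderiv_newTail_mulVec (hU : IsOpen U) (hG : IsMetric U G) (hB : ContDiffOn ℝ ∞ B U)
    (hp : p ∈ U) (X Y : V n) : fderiv ℝ (newTail G B) p X *ᵥ Y
      = B p • fderiv ℝ (hess G B) p X *ᵥ Y + (grad B p ⬝ᵥ X) • hess G B p *ᵥ Y
        - (grad B p ⬝ᵥ hess G B p *ᵥ X) • Y := by
  have hBd := differentiableAt_of_contDiffOn hU hB hp
  have hNd := differentiableAt_of_contDiffOn hU (hG.contDiffOn_hess hU hB) hp
  have hσd := differentiableAt_of_contDiffOn hU (hG.contDiffOn_gradInner hU hB hB) hp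
  have hNY : DifferentiableAt ℝ (fun q => hess G B q *ᵥ Y) p := differentiableAt_of_contDiffOn hU
    (contDiffOn_mulVec (hG.contDiffOn_hess hU hB) contDiffOn_const) hp
  rw [← fderiv_mulVec_const (differentiableAt_of_contDiffOn hU (contDiffOn_newTail hU hG hB) hp)]
  simp only [newTail_mulVec, gradSq_eq_gradInner]
  rw [fderiv_fun_sub (hBd.fun_smul hNY) ((hσd.const_mul _).smul_const Y),
    fderiv_fun_smul hBd hNY, fderiv_smul_const (hσd.const_mul _), fderiv_const_mul hσd]
  simp only [add_apply, sub_apply, smul_apply, ContinuousLinearMap.smulRight_apply,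
    hG.fderiv_gradInner hU hB hB hp, fderiv_mulVec_const hNd, fderiv_eq_grad_dotProduct B]
  module

theorem isCodazzi_newTail (hU : IsOpen U) (hG : IsMetric U G) (hflat : IsFlat U G)
    (hB : ContDiffOn ℝ ∞ B U) (hB0 : ∀ q ∈ U, B q ≠ 0) :
    IsCodazzi U (newMetric G B) (newTail G B) := by
  intro p hp X Y
  have hN := hG.isCodazzi_hess hU hflat hB p hp X Y
  have hg : (G p)⁻¹ *ᵥ Y ⬝ᵥ X = (G p)⁻¹ *ᵥ X ⬝ᵥ Y := by
    rw [mulVec_dotProduct_of_isSymm (hG.isSymm_inv hp), dotProduct_comm]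
  have hH : (G p)⁻¹ *ᵥ Y ⬝ᵥ hess G B p *ᵥ X = (G p)⁻¹ *ᵥ X ⬝ᵥ hess G B p *ᵥ Y := by
    have hlow (X : V n) : (G p)⁻¹ *ᵥ hess G B p *ᵥ X = covHess G B p *ᵥ X := by
      rw [hess_eq_mul_covHess, Matrix.mulVec_mulVec, ← Matrix.mul_assoc, hG.inv_mul hp,
        Matrix.one_mul]
    rw [mulVec_dotProduct_of_isSymm (hG.isSymm_inv hp),
      mulVec_dotProduct_of_isSymm (hG.isSymm_inv hp), hlow, hlow, dotProduct_comm,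
      mulVec_dotProduct_of_isSymm (hG.isSymm_covHess hU hB hp)]
  rw [fderiv_newTail_mulVec hU hG hB hp, fderiv_newTail_mulVec hU hG hB hp,
    conn_newMetric hU hG hB hB0 hp, conn_newMetric hU hG hB hB0 hp]
  simp only [Matrix.sub_mulVec, conformalShift_mulVec, newTail_mulVec, Matrix.mulVec_sub,
    Matrix.mulVec_smul, hg, hH, hG.conn_mulVec_comm hU hp Y X, eq_sub_of_add_eq hN]
  have := hB0 p hp
  match_scalars <;> field_simp <;> ring

theorem isConformalTail_newTail (hU : IsOpen U) (hG : IsMetric U G) (hflat : IsFlat U G)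
    (hB : ContDiffOn ℝ ∞ B U) (hB0 : ∀ q ∈ U, B q ≠ 0) :
    IsConformalTail U (newMetric G B) (newTail G B) where
  smooth := contDiffOn_newTail hU hG hB
  isSymm p hp := by
    rw [newMetric_inv_mul_newTail hG hB0 hp]
    exact (((hG.isSymm_covHess hU hB hp).smul _).sub ((hG.isSymm_inv hp).smul _)).smul _
  codazzi := isCodazzi_newTail hU hG hflat hB hB0
  curvOp_mulVec p hp X Y Z := by
    have h := smul_curvOp_newMetric hU hG hB hB0 hp X Y Z
    rw [hG.curvOp_eq_zero hU hflat hp, Matrix.zero_mulVec, sub_zero] at h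
    rw [newMetric_inv hG hB0 hp, ← inv_smul_smul₀ (pow_ne_zero 2 (hB0 p hp))
      (curvOp _ p X Y *ᵥ Z), h]
    simp only [Matrix.smul_mulVec, smul_dotProduct, smul_eq_mul]
    module

theorem pd_eq_of_eqOn {f g : V n → ℝ} (hU : IsOpen U) (hp : p ∈ U) (h : Set.EqOn f g U)
    (k : Fin n) : pd k f p = pd k g p := by
  rw [pd, pd, fderiv_eq_of_eqOn hU hp h]

theorem isFlat_congr {G' : V n → Matrix (Fin n) (Fin n) ℝ} (hU : IsOpen U) (h : Set.EqOn G G' U)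
    (hG : IsFlat U G) : IsFlat U G' := by
  have hΓ (p) (hp : p ∈ U) : christoffel G' p = christoffel G p := by
    have hinv (i j s : Fin n) : pd s (fun q => (G' q)⁻¹ i j) p = pd s (fun q => (G q)⁻¹ i j) p :=
      pd_eq_of_eqOn hU hp (fun q hq => by simp only [h hq]) s
    ext j s k
    simp only [christoffel, hinv, h hp]
  intro p hp i j k l
  have hdΓ (i j k s : Fin n) :
      pd s (fun q => christoffel G' q i j k) p = pd s (fun q => christoffel G q i j k) p :=
    pd_eq_of_eqOn hU hp (fun q hq => by simp only [hΓ q hq]) s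
  rw [← hG p hp i j k l]
  simp only [riemann, hdΓ, hΓ p hp]

theorem isConformallyFlat_newMetric (hU : IsOpen U) (hG : IsMetric U G) (hflat : IsFlat U G)
    (hB : ContDiffOn ℝ ∞ B U) (hB0 : ∀ q ∈ U, B q ≠ 0) :
    IsConformallyFlat U (newMetric G B) := by
  have hc : ContDiffOn ℝ ∞ (fun q => (B q)⁻¹) U := hB.inv hB0
  have hc0 (q) (hq : q ∈ U) : (B q)⁻¹ ≠ 0 := inv_ne_zero (hB0 q hq)
  have heq : Set.EqOn G (fun q => (B q)⁻¹ ^ 2 • newMetric G B q) U := fun q hq => by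
    simp only [newMetric, inv_pow, inv_smul_smul₀ (pow_ne_zero 2 (hB0 q hq))]
  exact fun p hp => ⟨U, hU, hp, subset_rfl, _, hc.pow 2, fun q hq => sq_pos_of_ne_zero (hc0 q hq),
    isMetric_newMetric (isMetric_newMetric hG hB hB0) hc hc0, isFlat_congr hU heq hflat⟩

end ConformalTail

section Systems

variable {n m : ℕ} {U : Set (V n)} {G : V n → Matrix (Fin n) (Fin n) ℝ} {p : V n}

/-- The covariant derivative `D_x ψ` of a covector field `ψ` along the curve `u`. -/
def covAlong (G : V n → Matrix (Fin n) (Fin n) ℝ) (u ψ : ℝ → V n) (x : ℝ) : V n :=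
  deriv ψ x - (conn G (u x) (deriv u x))ᵀ *ᵥ ψ x

theorem hasDerivAt_comp_curve {f : V n → ℝ} {u : ℝ → V n} {u' : V n} {x : ℝ}
    (hf : DifferentiableAt ℝ f (u x)) (hu : HasDerivAt u u' x) :
    HasDerivAt (fun y => f (u y)) (grad f (u x) ⬝ᵥ u') x := by
  rw [← fderiv_eq_grad_dotProduct]
  exact hf.hasFDerivAt.comp_hasDerivAt x hu

/-- The density `ψ_j a^j_l u_x^l` of the affinor `a` along the curve `u`. With `a = O.right α` it
is `O.integrand u ψ α`, and with `a = O.left α` it is the factor by which the `α`-th term of the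
tail is multiplied when `O.op u ζ` is paired with `ψ`. -/
def tailDensity (a : V n → Matrix (Fin n) (Fin n) ℝ) (u ψ : ℝ → V n) (x : ℝ) : ℝ :=
  ψ x ⬝ᵥ a (u x) *ᵥ deriv u x

theorem HydroOp.integrand_eq (O : HydroOp n m) (u ψ : ℝ → V n) (α : Fin m) :
    O.integrand u ψ α = tailDensity (O.right α) u ψ := by
  ext x
  simp only [integrand, tailDensity, dotProduct, Matrix.mulVec, Finset.mul_sum, mul_comm]

theorem HydroOp.act_eq (hU : IsOpen U) (O : HydroOp n m) (hG : IsMetric U O.metric)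
    {u : ℝ → V n} {x : ℝ} (hux : u x ∈ U) (ψ : ℝ → V n) (φ : Fin m → ℝ → ℝ) :
    O.act u ψ φ x = O.metric (u x) *ᵥ covAlong O.metric u ψ x
      + ∑ α, φ α x • O.left α (u x) *ᵥ deriv u x := by
  ext i
  have hΓ : ∑ j, ∑ s, ∑ k,
        O.metric (u x) i s * christoffel O.metric (u x) j s k * deriv u x k * ψ x j
      = ∑ s, O.metric (u x) i s * ∑ j, conn O.metric (u x) (deriv u x) j s * ψ x j := by
    simp only [conn, Matrix.of_apply, Finset.mul_sum, Finset.sum_mul]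
    rw [Finset.sum_comm]
    exact Finset.sum_congr rfl fun s _ => Finset.sum_congr rfl fun j _ =>
      Finset.sum_congr rfl fun k _ => by rw [hG.christoffel_symm hU hux]; ring
  rw [act, hΓ, ← Finset.sum_sub_distrib]
  simp [covAlong, Matrix.mulVec, dotProduct, Finset.sum_apply, mul_sub, mul_comm (φ _ _)]

theorem IsMetric.covAlong_gradAlong (hU : IsOpen U) (hG : IsMetric U G) {f : V n → ℝ}
    (hf : ContDiffOn ℝ ∞ f U) {u : ℝ → V n} {x : ℝ} (hu : DifferentiableAt ℝ u x) (hux : u x ∈ U) :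
    covAlong G u (gradAlong f u) x = covHess G f (u x) *ᵥ deriv u x := by
  rw [hG.covHess_mulVec hU hf hux, covAlong]
  have h := (differentiableAt_of_contDiffOn hU (contDiffOn_grad hU hf) hux).hasFDerivAt
  exact congrArg (· - _) (h.comp_hasDerivAt x hu.hasDerivAt).deriv

theorem HydroOp.act_gradAlong (hU : IsOpen U) (O : HydroOp n m) (hG : IsMetric U O.metric)
    {f : V n → ℝ} (hf : ContDiffOn ℝ ∞ f U) {u : ℝ → V n} {x : ℝ} (hu : DifferentiableAt ℝ u x)
    (hux : u x ∈ U) (φ : Fin m → ℝ → ℝ) :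
    O.act u (gradAlong f u) φ x = hess O.metric f (u x) *ᵥ deriv u x
      + ∑ α, φ α x • O.left α (u x) *ᵥ deriv u x := by
  rw [O.act_eq hU hG hux, hG.covAlong_gradAlong hU hf hu hux, Matrix.mulVec_mulVec,
    ← hess_eq_mul_covHess]

theorem eq_hess_of_isHamiltonianSystem (hU : IsOpen U) (hG : IsMetric U G) {h : V n → ℝ}
    (hh : ContDiffOn ℝ ∞ h U) {v : V n → Matrix (Fin n) (Fin n) ℝ} {Q : Fin 0 → V n → ℝ}
    (hv : IsHamiltonianSystem U v (localOp G) h Q) (hp : p ∈ U) : v p = hess G h p := by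
  refine Matrix.mulVec_injective (funext fun X => ?_)
  have hline : HasDerivAt (fun y : ℝ => p + y • X) X 0 := by
    simpa using ((hasDerivAt_id (0 : ℝ)).smul_const X).const_add p
  have h0 : p + (0 : ℝ) • X = p := by simp
  have hflow := hv.flow (fun y => p + y • X) 0 (by fun_prop) (by rwa [h0])
  rw [HydroOp.act_gradAlong hU (localOp G) hG hh hline.differentiableAt (by rwa [h0]),
    hline.deriv, h0] at hflow
  simpa [localOp] using hflow

variable {A B f h : V n → ℝ}

theorem grad_mul (hB : DifferentiableAt ℝ B p) (hf : DifferentiableAt ℝ f p) :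
    grad (fun q => B q * f q) p = B p • grad f p + f p • grad B p := by
  ext k
  simp [grad, pd, fderiv_fun_mul hB hf]

theorem hess_mulVec_of_eq_mul (hU : IsOpen U) (hG : IsMetric U G) (hB : ContDiffOn ℝ ∞ B U)
    (hf : ContDiffOn ℝ ∞ f U) (hh : Set.EqOn h (fun q => B q * f q) U) (hp : p ∈ U) (X : V n) :
    hess G h p *ᵥ X = B p • hess G f p *ᵥ X + (grad B p ⬝ᵥ X) • G p *ᵥ grad f p
      + (grad f p ⬝ᵥ X) • G p *ᵥ grad B p + f p • hess G B p *ᵥ X := by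
  have hd {F : V n → ℝ} (hF : ContDiffOn ℝ ∞ F U) {q : V n} (hq : q ∈ U) :=
    differentiableAt_of_contDiffOn hU hF hq
  have hdgrad {F : V n → ℝ} (hF : ContDiffOn ℝ ∞ F U) :=
    differentiableAt_of_contDiffOn hU (contDiffOn_grad hU hF) hp
  have hgrad : Set.EqOn (grad h) (fun q => B q • grad f q + f q • grad B q) U := fun q hq => by
    exact .trans (funext fun k => pd_eq_of_eqOn hU hq hh k) (grad_mul (hd hB hq) (hd hf hq))
  have hcov : covHess G h p *ᵥ X = B p • covHess G f p *ᵥ X + (grad B p ⬝ᵥ X) • grad f p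
      + (grad f p ⬝ᵥ X) • grad B p + f p • covHess G B p *ᵥ X := by
    have hhU : ContDiffOn ℝ ∞ h U := (hB.mul hf).congr hh
    rw [hG.covHess_mulVec hU hhU hp, hG.covHess_mulVec hU hf hp, hG.covHess_mulVec hU hB hp,
      fderiv_eq_of_eqOn hU hp hgrad, hgrad hp, fderiv_fun_add ((hd hB hp).fun_smul (hdgrad hf))
      ((hd hf hp).fun_smul (hdgrad hB)), fderiv_fun_smul (hd hB hp) (hdgrad hf),
      fderiv_fun_smul (hd hf hp) (hdgrad hB)]
    simp only [add_apply, smul_apply, ContinuousLinearMap.smulRight_apply,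
      fderiv_eq_grad_dotProduct B, fderiv_eq_grad_dotProduct f, Matrix.mulVec_add,
      Matrix.mulVec_smul]
    module
  simp only [hess_eq_mul_covHess, ← Matrix.mulVec_mulVec, hcov, Matrix.mulVec_add,
    Matrix.mulVec_smul]

/-- The primitive `P = B ⟨∇B, ∇f⟩ + ½ f (∇B)² - A` of `w̃^j_k u_x^k ∂_j f`, where `w̃` is
`newTail G B` and `A` is the current of the density `B` for the flow with the Hamiltonian density
`B f`. -/
def tailPrimitive (G : V n → Matrix (Fin n) (Fin n) ℝ) (A B f : V n → ℝ) (p : V n) : ℝ :=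
  B p * gradInner G B f p + (1 / 2) * f p * gradSq G B p - A p

theorem contDiffOn_tailPrimitive (hU : IsOpen U) (hG : IsMetric U G) (hA : ContDiffOn ℝ ∞ A U)
    (hB : ContDiffOn ℝ ∞ B U) (hf : ContDiffOn ℝ ∞ f U) :
    ContDiffOn ℝ ∞ (tailPrimitive G A B f) U := by
  have hBf := hG.contDiffOn_gradInner hU hB hf
  have hBB := hG.contDiffOn_gradInner hU hB hB
  unfold tailPrimitive
  simp only [gradSq_eq_gradInner]
  fun_prop

theorem newMatrix_mulVec_eq {v : V n → Matrix (Fin n) (Fin n) ℝ} (hU : IsOpen U)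
    (hG : IsMetric U G) (hB : ContDiffOn ℝ ∞ B U) (hB0 : ∀ q ∈ U, B q ≠ 0)
    (hf : ContDiffOn ℝ ∞ f U) (hh : Set.EqOn h (fun q => B q * f q) U) (hp : p ∈ U)
    (hv : v p = hess G h p) (X : V n) :
    newMatrix v B A p *ᵥ X = hess (newMetric G B) f p *ᵥ X + f p • newTail G B p *ᵥ X
      + tailPrimitive G A B f p • X := by
  rw [newMatrix, Matrix.sub_mulVec, Matrix.smul_mulVec, Matrix.smul_mulVec, Matrix.one_mulVec, hv,
    hess_mulVec_of_eq_mul hU hG hB hf hh hp, hess_newMetric_mulVec hU hG hB hB0 hf hp,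
    newTail_mulVec, tailPrimitive]
  module

theorem fderiv_tailPrimitive {v : V n → Matrix (Fin n) (Fin n) ℝ} (hU : IsOpen U)
    (hG : IsMetric U G) (hA : ContDiffOn ℝ ∞ A U) (hB : ContDiffOn ℝ ∞ B U)
    (hf : ContDiffOn ℝ ∞ f U) (hh : Set.EqOn h (fun q => B q * f q) U) (hp : p ∈ U)
    (hv : v p = hess G h p) (hcons : IsConservationLaw U v B A) (X : V n) :
    fderiv ℝ (tailPrimitive G A B f) p X = grad f p ⬝ᵥ newTail G B p *ᵥ X := by
  have hd {F : V n → ℝ} (hF : ContDiffOn ℝ ∞ F U) := differentiableAt_of_contDiffOn hU hF hp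
  have hBf := hd (hG.contDiffOn_gradInner hU hB hf)
  have hBB := hd (hG.contDiffOn_gradInner hU hB hB)
  have hA' : fderiv ℝ A p X = grad B p ⬝ᵥ hess G h p *ᵥ X := by
    rw [← hv, ← hcons p hp, fderiv_eq_grad_dotProduct]
  unfold tailPrimitive
  simp only [gradSq_eq_gradInner]
  rw [fderiv_fun_sub (((hd hB).fun_mul hBf).fun_add (((hd hf).const_mul _).fun_mul hBB)) (hd hA),
    fderiv_fun_add ((hd hB).fun_mul hBf) (((hd hf).const_mul _).fun_mul hBB),
    fderiv_fun_mul (hd hB) hBf, fderiv_fun_mul ((hd hf).const_mul _) hBB,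
    fderiv_const_mul (hd hf)]
  simp only [add_apply, sub_apply, smul_apply, smul_eq_mul, hG.fderiv_gradInner hU hB hf hp,
    hG.fderiv_gradInner hU hB hB hp, hA', hess_mulVec_of_eq_mul hU hG hB hf hh hp,
    newTail_mulVec, gradSq_eq_gradInner, dotProduct_add, dotProduct_sub, dotProduct_smul,
    fderiv_eq_grad_dotProduct B, fderiv_eq_grad_dotProduct f, gradInner]
  ring

theorem isHamiltonianSystem_newMatrix {v : V n → Matrix (Fin n) (Fin n) ℝ} (hU : IsOpen U)
    (hG : IsMetric U G) (hA : ContDiffOn ℝ ∞ A U) (hB : ContDiffOn ℝ ∞ B U)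
    (hB0 : ∀ q ∈ U, B q ≠ 0) (hf : ContDiffOn ℝ ∞ f U) (hh : Set.EqOn h (fun q => B q * f q) U)
    (hv : ∀ q ∈ U, v q = hess G h q) (hcons : IsConservationLaw U v B A) :
    IsHamiltonianSystem U (newMatrix v B A) (conformalOp (newMetric G B) (newTail G B)) f
      ![f, tailPrimitive G A B f] where
  smooth := Fin.forall_fin_two.2 ⟨hf, contDiffOn_tailPrimitive hU hG hA hB hf⟩
  primitive u x hu hux := by
    have hu' := (hu.differentiableAt (by simp)).hasDerivAt
    have hP := contDiffOn_tailPrimitive hU hG hA hB hf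
    have h0 := hasDerivAt_comp_curve (differentiableAt_of_contDiffOn hU hf hux) hu'
    have h1 := hasDerivAt_comp_curve (differentiableAt_of_contDiffOn hU hP hux) hu'
    rw [← fderiv_eq_grad_dotProduct,
      fderiv_tailPrimitive hU hG hA hB hf hh hux (hv _ hux) hcons] at h1
    simp only [HydroOp.integrand_eq, tailDensity, Fin.forall_fin_two]
    exact ⟨h0.congr_deriv (congrArg (grad f (u x) ⬝ᵥ ·) (Matrix.one_mulVec _).symm), h1⟩
  flow u x hu hux := by
    rw [HydroOp.act_gradAlong hU _ (isMetric_newMetric hG hB hB0) hf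
      (hu.differentiableAt (by simp)) hux,
      newMatrix_mulVec_eq hU hG hB hB0 hf hh hux (hv _ hux)]
    simp [conformalOp, Fin.sum_univ_two, add_assoc]

end Systems

section Reciprocal

/-- The linear automorphism `(x, t) ↦ (b x + a t, t)` of the plane, which is the differential of
`(x, t) ↦ (x̃, t)`. -/
def shearEquiv (a b : ℝ) (hb : b ≠ 0) : (ℝ × ℝ) ≃L[ℝ] (ℝ × ℝ) :=
  ContinuousLinearEquiv.equivOfInverse
    ((b • ContinuousLinearMap.fst ℝ ℝ ℝ + a • ContinuousLinearMap.snd ℝ ℝ ℝ).prod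
      (ContinuousLinearMap.snd ℝ ℝ ℝ))
    ((b⁻¹ • (ContinuousLinearMap.fst ℝ ℝ ℝ - a • ContinuousLinearMap.snd ℝ ℝ ℝ)).prod
      (ContinuousLinearMap.snd ℝ ℝ ℝ))
    (fun z => by ext <;> simp; field_simp)
    (fun z => by ext <;> simp; field_simp; ring)

theorem hasDerivAt_prodMk_left {E : Type*} [NormedAddCommGroup E] [NormedSpace ℝ E] {f : ℝ × ℝ → E}
    {z : ℝ × ℝ} {L : ℝ × ℝ →L[ℝ] E} (hf : HasFDerivAt f L z) :
    HasDerivAt (fun x => f (x, z.2)) (L (1, 0)) z.1 :=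
  hf.comp_hasDerivAt z.1 ((hasDerivAt_id z.1).prodMk (hasDerivAt_const z.1 z.2))

theorem hasDerivAt_prodMk_right {E : Type*} [NormedAddCommGroup E] [NormedSpace ℝ E] {f : ℝ × ℝ → E}
    {z : ℝ × ℝ} {L : ℝ × ℝ →L[ℝ] E} (hf : HasFDerivAt f L z) :
    HasDerivAt (fun t => f (z.1, t)) (L (0, 1)) z.2 :=
  hf.comp_hasDerivAt z.2 ((hasDerivAt_const z.2 z.1).prodMk (hasDerivAt_id z.2))

variable {n : ℕ} {U : Set (V n)} {v : V n → Matrix (Fin n) (Fin n) ℝ} {B A : V n → ℝ}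
  {D : Set (ℝ × ℝ)} {u : ℝ × ℝ → V n} {X : ℝ × ℝ → ℝ} {u' : ℝ × ℝ → V n} {z : ℝ × ℝ}

namespace IsReciprocal

theorem hasFDerivAt_prodMk (hR : IsReciprocal B A D u X u') (hz : z ∈ D) (hB0 : B (u z) ≠ 0) :
    HasFDerivAt (fun z => (X z, z.2))
      (shearEquiv (A (u z)) (B (u z)) hB0 : (ℝ × ℝ) →L[ℝ] (ℝ × ℝ)) z :=
  (hR.dX z hz).prodMk hasFDerivAt_snd

theorem contDiffOn (hR : IsReciprocal B A D u X u') (hu : IsSolution U v D u)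
    (hB : ContDiffOn ℝ ∞ B U) (hA : ContDiffOn ℝ ∞ A U) : ContDiffOn ℝ ∞ X D := by
  rw [contDiffOn_infty_iff_fderiv_of_isOpen hu.isOpen]
  refine ⟨fun z hz => (hR.dX z hz).differentiableAt.differentiableWithinAt, ?_⟩
  have hBu := hB.comp hu.smooth hu.mem
  have hAu := hA.comp hu.smooth hu.mem
  exact ((hBu.smul contDiffOn_const).add (hAu.smul contDiffOn_const)).congr
    fun z hz => (hR.dX z hz).fderiv

theorem exists_localInverse (hR : IsReciprocal B A D u X u') (hu : IsSolution U v D u)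
    (hB : ContDiffOn ℝ ∞ B U) (hA : ContDiffOn ℝ ∞ A U) (hB0 : ∀ p ∈ U, B p ≠ 0) (hz : z ∈ D) :
    ∃ ψ : ℝ × ℝ → ℝ × ℝ, ContDiffAt ℝ ∞ ψ (X z, z.2) ∧ ψ (X z, z.2) = z ∧
      ∀ᶠ y in 𝓝 (X z, z.2), ψ y ∈ D ∧ (X (ψ y), (ψ y).2) = y := by
  have hX := (hR.contDiffOn hu hB hA).contDiffAt (hu.isOpen.mem_nhds hz)
  have hΦ : ContDiffAt ℝ ∞ (fun z : ℝ × ℝ => (X z, z.2)) z := hX.prodMk contDiffAt_snd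
  have hΦ' := hR.hasFDerivAt_prodMk hz (hB0 _ (hu.mem z hz))
  have hs := hΦ.hasStrictFDerivAt' hΦ' (by simp)
  have hψ : ContDiffAt ℝ ∞ (hs.localInverse _ _ _) (X z, z.2) := hΦ.to_localInverse hΦ' (by simp)
  have hψz : hs.localInverse _ _ _ (X z, z.2) = z := hs.localInverse_apply_image
  refine ⟨hs.localInverse _ _ _, hψ, hψz, Filter.Eventually.and ?_ hs.eventually_right_inverse⟩
  exact hψ.continuousAt.eventually_mem (by rw [hψz]; exact hu.isOpen.mem_nhds hz)

theorem isOpen_image (hR : IsReciprocal B A D u X u') (hu : IsSolution U v D u)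
    (hB : ContDiffOn ℝ ∞ B U) (hA : ContDiffOn ℝ ∞ A U) (hB0 : ∀ p ∈ U, B p ≠ 0) :
    IsOpen ((fun z => (X z, z.2)) '' D) := by
  rw [isOpen_iff_mem_nhds]
  rintro _ ⟨z, hz, rfl⟩
  obtain ⟨ψ, -, -, hψ⟩ := hR.exists_localInverse hu hB hA hB0 hz
  filter_upwards [hψ] with y hy using ⟨ψ y, hy.1, hy.2⟩

theorem contDiffAt_field (hR : IsReciprocal B A D u X u') (hu : IsSolution U v D u)
    (hB : ContDiffOn ℝ ∞ B U) (hA : ContDiffOn ℝ ∞ A U) (hB0 : ∀ p ∈ U, B p ≠ 0) (hz : z ∈ D) :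
    ContDiffAt ℝ ∞ u' (X z, z.2) := by
  obtain ⟨ψ, hψ, hψz, hinv⟩ := hR.exists_localInverse hu hB hA hB0 hz
  have huz : ContDiffAt ℝ ∞ u (ψ (X z, z.2)) := by
    rw [hψz]
    exact hu.smooth.contDiffAt (hu.isOpen.mem_nhds hz)
  refine (huz.comp _ hψ).congr_of_eventuallyEq ?_
  filter_upwards [hinv] with y hy
  rw [Function.comp_apply, ← hR.field _ hy.1, hy.2]

theorem deriv_field (hR : IsReciprocal B A D u X u') (hu : IsSolution U v D u) (hz : z ∈ D)
    (hB0 : B (u z) ≠ 0) (hu' : DifferentiableAt ℝ u' (X z, z.2)) :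
    deriv (fun t => u' (X z, t)) z.2
      = newMatrix v B A (u z) *ᵥ deriv (fun x => u' (x, z.2)) (X z) := by
  set L := fderiv ℝ u' (X z, z.2) with hL
  have hcomp : HasFDerivAt u (L.comp (shearEquiv (A (u z)) (B (u z)) hB0 : _ →L[ℝ] ℝ × ℝ)) z := by
    refine (hu'.hasFDerivAt.comp z (hR.hasFDerivAt_prodMk hz hB0)).congr_of_eventuallyEq ?_
    filter_upwards [hu.isOpen.mem_nhds hz] with y hy using (hR.field y hy).symm
  have hx : deriv (fun x => u (x, z.2)) z.1 = B (u z) • L (1, 0) := by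
    rw [(hasDerivAt_prodMk_left hcomp).deriv, ← map_smul]
    simp [shearEquiv]
  have ht : deriv (fun t => u (z.1, t)) z.2 = A (u z) • L (1, 0) + L (0, 1) := by
    rw [(hasDerivAt_prodMk_right hcomp).deriv, ← map_smul, ← map_add]
    simp [shearEquiv]
  have hsol := hu.eq z hz
  rw [hx, ht, Matrix.mulVec_smul] at hsol
  rw [(hasDerivAt_prodMk_right (z := (X z, z.2)) hu'.hasFDerivAt).deriv,
    (hasDerivAt_prodMk_left (z := (X z, z.2)) hu'.hasFDerivAt).deriv, ← hL, newMatrix,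
    Matrix.sub_mulVec, Matrix.smul_mulVec, Matrix.smul_mulVec, Matrix.one_mulVec, ← hsol]
  abel

theorem isSolution (hR : IsReciprocal B A D u X u') (hu : IsSolution U v D u)
    (hB : ContDiffOn ℝ ∞ B U) (hA : ContDiffOn ℝ ∞ A U) (hB0 : ∀ p ∈ U, B p ≠ 0) :
    IsSolution U (newMatrix v B A) ((fun z => (X z, z.2)) '' D) u' where
  isOpen := hR.isOpen_image hu hB hA hB0
  smooth := by
    rintro _ ⟨z, hz, rfl⟩
    exact (hR.contDiffAt_field hu hB hA hB0 hz).contDiffWithinAt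
  mem := by
    rintro _ ⟨z, hz, rfl⟩
    rw [hR.field z hz]
    exact hu.mem z hz
  eq := by
    rintro _ ⟨z, hz, rfl⟩
    rw [hR.field z hz]
    exact hR.deriv_field hu hz (hB0 _ (hu.mem z hz))
      ((hR.contDiffAt_field hu hB hA hB0 hz).differentiableAt (by simp))

end IsReciprocal

end Reciprocal

section Primitives

open MeasureTheory Set

/-- The function vanishes outside `(-R, R)`. On such functions the integrals over `ℝ` in the
definitions of `dInv` and `pairing` are integrals over one fixed compact interval. -/
def SuppIn {E : Type*} [Zero E] (R : ℝ) (f : ℝ → E) : Prop := ∀ x, x ∉ Ioo (-R) R → f x = 0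

theorem exists_suppIn {E : Type*} [Zero E] {f : ℝ → E}
    (hf : HasCompactSupport f) : ∃ R, ∀ R', R ≤ R' → SuppIn R' f := by
  obtain ⟨r, hr⟩ := hf.isCompact.isBounded.subset_closedBall 0
  refine ⟨|r| + 1, fun R' hR' x hx => ?_⟩
  by_contra h
  have h1 := hr (subset_tsupport f h)
  rw [Metric.mem_closedBall, dist_zero_right, Real.norm_eq_abs] at h1
  have h2 := abs_lt.1 (h1.trans_lt ((le_abs_self r).trans_lt ((lt_add_one |r|).trans_le hR')))
  exact hx h2

theorem SuppIn.hasCompactSupport {E : Type*} [Zero E] {R : ℝ} {f : ℝ → E}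
    (hf : SuppIn R f) : HasCompactSupport f :=
  HasCompactSupport.intro (isCompact_Icc (a := -R) (b := R)) fun x hx =>
    hf x fun h => hx (Ioo_subset_Icc_self h)

theorem integral_eq_of_suppIn {R : ℝ} {f : ℝ → ℝ} (hs : SuppIn R f) :
    ∫ x, f x = ∫ x in (-R)..R, f x := by
  refine (intervalIntegral.integral_eq_integral_of_support_subset fun x hx => ?_).symm
  by_contra h
  exact hx (hs x fun h' => h (Ioo_subset_Ioc_self h'))

/-- The primitive of `f` with opposite values at `±R`; for `f` supported in `(-R, R)` it is
`dInv f`. -/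
def prim (R : ℝ) (f : ℝ → ℝ) (x : ℝ) : ℝ :=
  (∫ y in (-R)..x, f y) - (1 / 2) * ∫ y in (-R)..R, f y

theorem dInv_eq_prim {R : ℝ} {f : ℝ → ℝ} (hf : Continuous f) (hs : SuppIn R f) (x : ℝ) :
    dInv f x = prim R f x := by
  have hi : Integrable f := hf.integrable_of_hasCompactSupport hs.hasCompactSupport
  have h1 : ∫ y in Iic (-R), f y = 0 :=
    setIntegral_eq_zero_of_forall_eq_zero fun y hy => hs y fun h => not_lt.2 hy h.1
  have h2 := intervalIntegral.integral_Iic_sub_Iic (a := -R) (b := x) hi.integrableOn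
    hi.integrableOn
  have h3 := intervalIntegral.integral_Iic_add_Ioi (b := x) hi.integrableOn hi.integrableOn
  rw [integral_eq_of_suppIn hs] at h3
  rw [dInv, prim, ← h2, ← h3, h1]
  ring

theorem hasDerivAt_prim (R : ℝ) {f : ℝ → ℝ} (hf : Continuous f) (x : ℝ) :
    HasDerivAt (prim R f) (f x) x :=
  (intervalIntegral.integral_hasDerivAt_right (hf.intervalIntegrable _ _)
    (hf.stronglyMeasurableAtFilter _ _) hf.continuousAt).sub_const _

theorem continuous_prim (R : ℝ) {f : ℝ → ℝ} (hf : Continuous f) : Continuous (prim R f) :=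
  continuous_iff_continuousAt.2 fun x => (hasDerivAt_prim R hf x).continuousAt

theorem contDiff_prim (R : ℝ) {f : ℝ → ℝ} (hf : ContDiff ℝ ∞ f) : ContDiff ℝ ∞ (prim R f) := by
  rw [contDiff_infty_iff_deriv]
  have h := hasDerivAt_prim R hf.continuous
  refine ⟨fun x => (h x).differentiableAt, ?_⟩
  rwa [show deriv (prim R f) = f from funext fun x => (h x).deriv]

theorem prim_apply_self (R : ℝ) (f : ℝ → ℝ) : prim R f R = -prim R f (-R) := by
  simp only [prim, intervalIntegral.integral_same]
  ring

theorem integral_mul_prim (R : ℝ) {f g : ℝ → ℝ} (hf : Continuous f) (hg : Continuous g) :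
    ∫ x in (-R)..R, g x * prim R f x = -∫ x in (-R)..R, f x * prim R g x := by
  have hpf := continuous_prim R hf
  have hpg := continuous_prim R hg
  have h := intervalIntegral.integral_eq_sub_of_hasDerivAt (a := -R) (b := R)
    (fun x _ => (hasDerivAt_prim R hf x).fun_mul (hasDerivAt_prim R hg x))
    (Continuous.intervalIntegrable (by fun_prop) _ _)
  rw [intervalIntegral.integral_add (Continuous.intervalIntegrable (by fun_prop) _ _)
    (Continuous.intervalIntegrable (by fun_prop) _ _), prim_apply_self, prim_apply_self] at h
  simp only [mul_comm (g _)]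
  linarith

theorem continuous_uncurry_prim (R : ℝ) {f : ℝ → ℝ → ℝ} (hf : Continuous (Function.uncurry f)) :
    Continuous (Function.uncurry fun ε => prim R (f ε)) :=
  (intervalIntegral.continuous_parametric_primitive_of_continuous (a₀ := -R) hf).sub
    (((intervalIntegral.continuous_parametric_intervalIntegral_of_continuous' hf (-R) R).comp
      continuous_fst).const_mul _)

/-- `f' ε x` is the derivative of `f ε x` in the parameter `ε`, and both are jointly continuous.
Such families can be differentiated under integrals over compact intervals. -/
structure HasFamilyDeriv (f f' : ℝ → ℝ → ℝ) : Prop where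
  cont : Continuous (Function.uncurry f)
  cont' : Continuous (Function.uncurry f')
  hasDerivAt : ∀ ε x, HasDerivAt (fun ε => f ε x) (f' ε x) ε

namespace HasFamilyDeriv

variable {f f' g g' : ℝ → ℝ → ℝ}

theorem cont_left (h : HasFamilyDeriv f f') (ε : ℝ) : Continuous (f ε) :=
  h.cont.comp (Continuous.prodMk_right ε)

theorem cont_left' (h : HasFamilyDeriv f f') (ε : ℝ) : Continuous (f' ε) :=
  h.cont'.comp (Continuous.prodMk_right ε)

theorem mul (hf : HasFamilyDeriv f f') (hg : HasFamilyDeriv g g') :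
    HasFamilyDeriv (fun ε x => f ε x * g ε x) (fun ε x => f' ε x * g ε x + f ε x * g' ε x) :=
  ⟨hf.cont.mul hg.cont, (hf.cont'.mul hg.cont).add (hf.cont.mul hg.cont'),
    fun ε x => (hf.hasDerivAt ε x).mul (hg.hasDerivAt ε x)⟩

theorem hasDerivAt_integral (hf : HasFamilyDeriv f f') (a b ε : ℝ) :
    HasDerivAt (fun ε => ∫ x in a..b, f ε x) (∫ x in a..b, f' ε x) ε := by
  obtain ⟨C, hC⟩ := ((isCompact_Icc (a := ε - 1) (b := ε + 1)).prod
    (isCompact_uIcc (a := a) (b := b))).exists_bound_of_continuousOn hf.cont'.continuousOn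
  refine (intervalIntegral.hasDerivAt_integral_of_dominated_loc_of_deriv_le (bound := fun _ => C)
    (Icc_mem_nhds (sub_one_lt ε) (lt_add_one ε))
    (Filter.Eventually.of_forall fun e => (hf.cont_left e).aestronglyMeasurable)
    ((hf.cont_left ε).intervalIntegrable _ _) (hf.cont_left' ε).aestronglyMeasurable
    (Filter.Eventually.of_forall fun x hx e he => hC (e, x) ⟨he, uIoc_subset_uIcc hx⟩)
    (continuous_const.intervalIntegrable _ _)
    (Filter.Eventually.of_forall fun x _ e _ => hf.hasDerivAt e x)).2

theorem prim (hf : HasFamilyDeriv f f') (R : ℝ) :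
    HasFamilyDeriv (fun ε => prim R (f ε)) (fun ε => HydroRecip.prim R (f' ε)) where
  cont := continuous_uncurry_prim R hf.cont
  cont' := continuous_uncurry_prim R hf.cont'
  hasDerivAt ε x := (hf.hasDerivAt_integral (-R) x ε).sub
    ((hf.hasDerivAt_integral (-R) R ε).const_mul _)

theorem hasDerivAt_integral_mul_prim (hf : HasFamilyDeriv f f') (hg : HasFamilyDeriv g g')
    (R ε : ℝ) : HasDerivAt (fun ε => ∫ x in (-R)..R, f ε x * HydroRecip.prim R (g ε) x)
      (∫ x in (-R)..R, (f' ε x * HydroRecip.prim R (g ε) x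
        - g' ε x * HydroRecip.prim R (f ε) x)) ε := by
  have hpf := continuous_prim R (hf.cont_left ε)
  have hpg := continuous_prim R (hg.cont_left ε)
  have hpg' := continuous_prim R (hg.cont_left' ε)
  have h₁ := ((hf.cont_left' ε).fun_mul hpg).intervalIntegrable (μ := volume) (-R) R
  have h₂ := ((hf.cont_left ε).fun_mul hpg').intervalIntegrable (μ := volume) (-R) R
  have h₃ := ((hg.cont_left' ε).fun_mul hpf).intervalIntegrable (μ := volume) (-R) R
  refine ((hf.mul (hg.prim R)).hasDerivAt_integral (-R) R ε).congr_deriv ?_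
  rw [intervalIntegral.integral_add h₁ h₂, intervalIntegral.integral_sub h₁ h₃,
    integral_mul_prim R (hg.cont_left' ε) (hf.cont_left ε), sub_eq_add_neg]

theorem of_contDiff (hf : ContDiff ℝ ∞ (Function.uncurry f))
    (hf' : ∀ ε x, HasDerivAt (fun ε => f ε x) (f' ε x) ε) : HasFamilyDeriv f f' where
  cont := hf.continuous
  cont' := ((hf.continuous_fderiv (by simp)).clm_apply
    (continuous_const (y := ((1, 0) : ℝ × ℝ)))).congr fun z =>
      (hasDerivAt_prodMk_left (hf.differentiable (by simp) z).hasFDerivAt).unique (hf' z.1 z.2)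
  hasDerivAt := hf'

end HasFamilyDeriv

end Primitives

section CurveCalculus

variable {n : ℕ} {U : Set (V n)} {G : V n → Matrix (Fin n) (Fin n) ℝ}
  {m : ℕ} {E : Type*} [NormedAddCommGroup E] [NormedSpace ℝ E]
  {M : E → Matrix (Fin m) (Fin n) ℝ} {F F' : E → V n}

@[fun_prop]
theorem contDiff_dotProduct (hF : ContDiff ℝ ∞ F) (hF' : ContDiff ℝ ∞ F') :
    ContDiff ℝ ∞ (fun z => F z ⬝ᵥ F' z) :=
  contDiffOn_univ.1 (contDiffOn_dotProduct hF.contDiffOn hF'.contDiffOn)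

@[fun_prop]
theorem contDiff_mulVec (hM : ContDiff ℝ ∞ M) (hF : ContDiff ℝ ∞ F) :
    ContDiff ℝ ∞ (fun z => M z *ᵥ F z) :=
  contDiffOn_univ.1 (contDiffOn_mulVec hM.contDiffOn hF.contDiffOn)

@[fun_prop]
theorem contDiff_transpose (hM : ContDiff ℝ ∞ M) : ContDiff ℝ ∞ (fun z => (M z)ᵀ) :=
  contDiffOn_univ.1 (contDiffOn_transpose hM.contDiffOn)

theorem IsMetric.contDiff_conn_comp (hU : IsOpen U) (hG : IsMetric U G) {γ X : E → V n}
    (hγ : ContDiff ℝ ∞ γ) (hγU : ∀ z, γ z ∈ U) (hX : ContDiff ℝ ∞ X) :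
    ContDiff ℝ ∞ (fun z => conn G (γ z) (X z)) := by
  have hΓ (i k j : Fin n) := (hG.contDiffOn_christoffel hU i k j).comp_contDiff hγ hγU
  refine contDiff_pi.2 fun i => contDiff_pi.2 fun j => ?_
  simp only [conn, Matrix.of_apply]
  exact ContDiff.sum fun k _ => (hΓ i k j).mul (contDiff_pi.1 hX k)

variable {N : ℝ → Matrix (Fin m) (Fin n) ℝ} {N' : Matrix (Fin m) (Fin n) ℝ}
  {K L : ℝ → V n} {K' L' : V n} {t : ℝ}

theorem hasDerivAt_dotProduct (hK : HasDerivAt K K' t) (hL : HasDerivAt L L' t) :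
    HasDerivAt (fun t => K t ⬝ᵥ L t) (K t ⬝ᵥ L' + K' ⬝ᵥ L t) t :=
  (dotProductBilin ℝ ℝ).toContinuousBilinearMap.hasDerivAt_of_bilinear (fun _ => hK) (fun _ => hL)

theorem hasDerivAt_mulVec (hN : HasDerivAt N N' t) (hK : HasDerivAt K K' t) :
    HasDerivAt (fun t => N t *ᵥ K t) (N t *ᵥ K' + N' *ᵥ K t) t :=
  (Matrix.mulVecBilin ℝ ℝ).toContinuousBilinearMap.hasDerivAt_of_bilinear
    (fun _ => hN) (fun _ => hK)

theorem hasDerivAt_transpose (hN : HasDerivAt N N' t) : HasDerivAt (fun t => (N t)ᵀ) N'ᵀ t :=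
  (Matrix.transposeLinearEquiv (Fin m) (Fin n) ℝ ℝ).toLinearMap.toContinuousLinearMap
    |>.hasFDerivAt.comp_hasDerivAt t hN

theorem hasDerivAt_matrix_comp {a : V n → Matrix (Fin m) (Fin m) ℝ} (hU : IsOpen U)
    (ha : ContDiffOn ℝ ∞ a U) {γ : ℝ → V n} {γ' : V n} (hγ : HasDerivAt γ γ' t) (hγU : γ t ∈ U) :
    HasDerivAt (fun t => a (γ t)) (fderiv ℝ a (γ t) γ') t :=
  (differentiableAt_of_contDiffOn hU ha hγU).hasFDerivAt.comp_hasDerivAt t hγ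

theorem IsMetric.hasDerivAt_conn (hU : IsOpen U) (hG : IsMetric U G) {γ X : ℝ → V n} {γ' X' : V n}
    (hγ : HasDerivAt γ γ' t) (hγU : γ t ∈ U) (hX : HasDerivAt X X' t) :
    HasDerivAt (fun t => conn G (γ t) (X t))
      (fderiv ℝ (fun q => conn G q (X t)) (γ t) γ' + conn G (γ t) X') t := by
  have hd (i k j : Fin n) :=
    differentiableAt_of_contDiffOn hU (hG.contDiffOn_christoffel hU i k j) hγU
  refine hasDerivAt_pi.2 fun i => hasDerivAt_pi.2 fun j => ?_
  change HasDerivAt (fun t => ∑ k, christoffel G (γ t) i k j * X t k) _ t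
  refine (HasDerivAt.fun_sum fun k _ => ((hd i k j).hasFDerivAt.comp_hasDerivAt t hγ).fun_mul
    (hasDerivAt_pi.1 hX k)).congr_deriv ?_
  rw [Matrix.add_apply, ← fderiv_matrix_apply
    (differentiableAt_of_contDiffOn hU (hG.contDiffOn_conn hU (X t)) hγU)]
  simp only [conn, Matrix.of_apply]
  rw [fderiv_fun_sum fun k _ => (hd i k j).mul_const (X t k)]
  simp only [fderiv_mul_const (hd i _ j)]
  simp [Finset.sum_add_distrib, mul_comm]

variable {γ : ℝ × ℝ → E}

theorem deriv_prodMk_right (hγ : ContDiff ℝ ∞ γ) (z : ℝ × ℝ) :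
    deriv (fun x => γ (z.1, x)) z.2 = fderiv ℝ γ z (0, 1) :=
  (hasDerivAt_prodMk_right (hγ.differentiable (by simp) z).hasFDerivAt).deriv

@[fun_prop]
theorem contDiff_deriv_prodMk_right (hγ : ContDiff ℝ ∞ γ) :
    ContDiff ℝ ∞ (fun z : ℝ × ℝ => deriv (fun x => γ (z.1, x)) z.2) := by
  simp only [deriv_prodMk_right hγ]
  exact (hγ.fderiv_right (m := ∞) (by simp)).clm_apply contDiff_const

theorem hasDerivAt_deriv_prodMk_right (hγ : ContDiff ℝ ∞ γ) (ε x : ℝ) :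
    HasDerivAt (fun ε => deriv (fun x => γ (ε, x)) x)
      (deriv (fun x => fderiv ℝ γ (ε, x) (1, 0)) x) ε := by
  have hd (X : ℝ × ℝ) : HasFDerivAt (fun z => fderiv ℝ γ z X)
      (fderiv ℝ (fun z => fderiv ℝ γ z X) (ε, x)) (ε, x) :=
    (((hγ.fderiv_right (m := ∞) (by simp)).clm_apply contDiff_const).differentiable (by simp)
      _).hasFDerivAt
  rw [(hasDerivAt_prodMk_right (hd (1, 0))).deriv, ← fderiv_fderiv_apply_comm isOpen_univ
    hγ.contDiffOn (Set.mem_univ _), funext fun ε => deriv_prodMk_right hγ (ε, x)]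
  exact hasDerivAt_prodMk_left (hd (0, 1))

end CurveCalculus

section Operators

variable {n m : ℕ} {U : Set (V n)} {G a w : V n → Matrix (Fin n) (Fin n) ℝ} {O : HydroOp n m}
  {R : ℝ} {u ψ η ζ : ℝ → V n}

/-- The coefficients of the operator are smooth on `U`, and its metric is a metric there. -/
structure HydroOp.IsSmoothOn (O : HydroOp n m) (U : Set (V n)) : Prop where
  metric : IsMetric U O.metric
  left : ∀ α, ContDiffOn ℝ ∞ (O.left α) U
  right : ∀ α, ContDiffOn ℝ ∞ (O.right α) U

/-- Smooth covector fields on the line that vanish outside `(-R, R)`. -/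
structure IsTestIn (R : ℝ) (ζ : ℝ → V n) : Prop where
  smooth : ContDiff ℝ ∞ ζ
  suppIn : SuppIn R ζ

theorem IsTest.exists_isTestIn (hζ : IsTest ζ) : ∃ R, ∀ R', R ≤ R' → IsTestIn R' ζ :=
  let ⟨R, hR⟩ := exists_suppIn hζ.2
  ⟨R, fun R' hR' => ⟨hζ.1, hR R' hR'⟩⟩

/-- The pairing density of `η` with the local part of the operator applied to `ζ`. -/
def localDensity (G : V n → Matrix (Fin n) (Fin n) ℝ) (u η ζ : ℝ → V n) (x : ℝ) : ℝ :=
  η x ⬝ᵥ G (u x) *ᵥ covAlong G u ζ x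

theorem contDiff_deriv {E : Type*} [NormedAddCommGroup E] [NormedSpace ℝ E] {f : ℝ → E}
    (hf : ContDiff ℝ ∞ f) : ContDiff ℝ ∞ (deriv f) :=
  (contDiff_infty_iff_deriv.1 hf).2

theorem contDiff_tailDensity (ha : ContDiffOn ℝ ∞ a U) (hu : ContDiff ℝ ∞ u) (huU : ∀ x, u x ∈ U)
    (hψ : ContDiff ℝ ∞ ψ) : ContDiff ℝ ∞ (tailDensity a u ψ) :=
  contDiff_dotProduct hψ (contDiff_mulVec (ha.comp_contDiff hu huU) (contDiff_deriv hu))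

theorem suppIn_tailDensity (hψ : SuppIn R ψ) : SuppIn R (tailDensity a u ψ) := fun x hx => by
  rw [tailDensity, hψ x hx, zero_dotProduct]

theorem IsMetric.contDiff_covAlong (hU : IsOpen U) (hG : IsMetric U G) (hu : ContDiff ℝ ∞ u)
    (huU : ∀ x, u x ∈ U) (hψ : ContDiff ℝ ∞ ψ) : ContDiff ℝ ∞ (covAlong G u ψ) :=
  (contDiff_deriv hψ).sub (contDiff_mulVec (contDiff_transpose
    (hG.contDiff_conn_comp hU hu huU (contDiff_deriv hu))) hψ)

theorem IsMetric.contDiff_localDensity (hU : IsOpen U) (hG : IsMetric U G) (hu : ContDiff ℝ ∞ u)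
    (huU : ∀ x, u x ∈ U) (hη : ContDiff ℝ ∞ η) (hζ : ContDiff ℝ ∞ ζ) :
    ContDiff ℝ ∞ (localDensity G u η ζ) :=
  contDiff_dotProduct hη (contDiff_mulVec (hG.contDiffOn.comp_contDiff hu huU)
    (hG.contDiff_covAlong hU hu huU hζ))

theorem IsMetric.hasDerivAt_dotProduct_mulVec (hU : IsOpen U) (hG : IsMetric U G)
    (hu : ContDiff ℝ ∞ u) {x : ℝ} (hux : u x ∈ U) (hη : ContDiff ℝ ∞ η) (hζ : ContDiff ℝ ∞ ζ) :
    HasDerivAt (fun y => η y ⬝ᵥ G (u y) *ᵥ ζ y)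
      (localDensity G u η ζ x + localDensity G u ζ η x) x := by
  have hd {f : ℝ → V n} (hf : ContDiff ℝ ∞ f) := (hf.differentiable (by simp) x).hasDerivAt
  have hGu := hasDerivAt_matrix_comp hU hG.contDiffOn (hd hu) hux
  refine (hasDerivAt_dotProduct (hd hη) (hasDerivAt_mulVec hGu (hd hζ))).congr_deriv ?_
  have hswap : localDensity G u ζ η x = covAlong G u η x ⬝ᵥ G (u x) *ᵥ ζ x := by
    rw [localDensity, ← mulVec_dotProduct_of_isSymm (hG.isSymm hux), dotProduct_comm]
  rw [hswap, localDensity, covAlong, covAlong, hG.fderiv_eq hU hux]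
  simp only [Matrix.neg_mulVec, Matrix.add_mulVec, ← Matrix.mulVec_mulVec,
    Matrix.mulVec_sub, dotProduct_sub, sub_dotProduct, dotProduct_add, dotProduct_neg,
    transpose_mulVec_dotProduct]
  ring

namespace HydroOp

theorem op_eq (hU : IsOpen U) (hO : O.IsSmoothOn U) (hu : ContDiff ℝ ∞ u) (huU : ∀ x, u x ∈ U)
    (hζ : IsTestIn R ζ) (x : ℝ) :
    O.op u ζ x = O.metric (u x) *ᵥ covAlong O.metric u ζ x
      + ∑ α, prim R (tailDensity (O.right α) u ζ) x • O.left α (u x) *ᵥ deriv u x := by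
  rw [op, O.act_eq hU hO.metric (huU x)]
  simp only [integrand_eq, dInv_eq_prim (contDiff_tailDensity (hO.right _) hu huU
    hζ.smooth).continuous (suppIn_tailDensity hζ.suppIn)]

theorem contDiff_op (hU : IsOpen U) (hO : O.IsSmoothOn U) (hu : ContDiff ℝ ∞ u)
    (huU : ∀ x, u x ∈ U) (hζ : IsTestIn R ζ) : ContDiff ℝ ∞ (O.op u ζ) := by
  rw [funext (op_eq hU hO hu huU hζ)]
  refine (contDiff_mulVec (hO.metric.contDiffOn.comp_contDiff hu huU)
    (hO.metric.contDiff_covAlong hU hu huU hζ.smooth)).add (ContDiff.sum fun α _ => ?_)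
  exact (contDiff_prim R (contDiff_tailDensity (hO.right α) hu huU hζ.smooth)).smul
    (contDiff_mulVec ((hO.left α).comp_contDiff hu huU) (contDiff_deriv hu))

theorem pairing_op_eq (hU : IsOpen U) (hO : O.IsSmoothOn U) (hu : ContDiff ℝ ∞ u)
    (huU : ∀ x, u x ∈ U) (hη : IsTestIn R η) (hζ : IsTestIn R ζ) :
    pairing η (O.op u ζ) = (∫ x in (-R)..R, localDensity O.metric u η ζ x)
      + ∑ α, ∫ x in (-R)..R,
          tailDensity (O.left α) u η x * prim R (tailDensity (O.right α) u ζ) x := by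
  have hl := (hO.metric.contDiff_localDensity hU hu huU hη.smooth hζ.smooth).continuous
  have ht (α : Fin m) : Continuous fun x =>
      tailDensity (O.left α) u η x * prim R (tailDensity (O.right α) u ζ) x :=
    (contDiff_tailDensity (hO.left α) hu huU hη.smooth).continuous.mul
      (continuous_prim R (contDiff_tailDensity (hO.right α) hu huU hζ.smooth).continuous)
  have hsupp : SuppIn R fun x => η x ⬝ᵥ O.op u ζ x := fun x hx => by
    simp only [hη.suppIn x hx, zero_dotProduct]
  refine (integral_eq_of_suppIn hsupp).trans ?_
  rw [← intervalIntegral.integral_finsetSum fun α _ => (ht α).intervalIntegrable _ _,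
    ← intervalIntegral.integral_add (hl.intervalIntegrable _ _)
      ((continuous_finsetSum _ fun α _ => ht α).intervalIntegrable _ _)]
  refine intervalIntegral.integral_congr fun x _ => ?_
  simp only [op_eq hU hO hu huU hζ, localDensity, tailDensity, dotProduct_add, dotProduct_sum,
    dotProduct_smul, smul_eq_mul, mul_comm]

theorem pairing_op_congr {u v : ℝ → V n} (hη : SuppIn R η) (hζ : SuppIn R ζ)
    (h : Set.EqOn u v (Set.Ioo (-R) R)) : pairing η (O.op u ζ) = pairing η (O.op v ζ) := by
  have hderiv {x : ℝ} (hx : x ∈ Set.Ioo (-R) R) : deriv u x = deriv v x :=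
    (h.eventuallyEq_of_mem (isOpen_Ioo.mem_nhds hx)).deriv_eq
  have hint (α : Fin m) : O.integrand u ζ α = O.integrand v ζ α := funext fun x => by
    by_cases hx : x ∈ Set.Ioo (-R) R
    · simp only [integrand, h hx, hderiv hx]
    · simp [integrand, hζ x hx]
  refine congrArg (MeasureTheory.integral _) (funext fun x => ?_)
  by_cases hx : x ∈ Set.Ioo (-R) R
  · simp only [op, act, hint, h hx, hderiv hx]
  · simp [hη x hx]

end HydroOp

theorem isSmoothOn_conformalOp (hG : IsMetric U G) (hw : ContDiffOn ℝ ∞ w U) :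
    (conformalOp G w).IsSmoothOn U where
  metric := hG
  left := Fin.forall_fin_two.2 ⟨hw, contDiffOn_const⟩
  right := Fin.forall_fin_two.2 ⟨contDiffOn_const, hw⟩

theorem integral_localDensity_swap (hU : IsOpen U) (hG : IsMetric U G) (hu : ContDiff ℝ ∞ u)
    (huU : ∀ x, u x ∈ U) (hη : IsTestIn R η) (hζ : IsTestIn R ζ) :
    ∫ x in (-R)..R, localDensity G u η ζ x = -∫ x in (-R)..R, localDensity G u ζ η x := by
  have hint {η ζ : ℝ → V n} (hη : IsTestIn R η) (hζ : IsTestIn R ζ) :=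
    (hG.contDiff_localDensity hU hu huU hη.smooth hζ.smooth).continuous.intervalIntegrable
      (μ := MeasureTheory.volume) (-R) R
  have h := intervalIntegral.integral_eq_sub_of_hasDerivAt (a := -R) (b := R)
    (fun x _ => hG.hasDerivAt_dotProduct_mulVec hU hu (huU x) hη.smooth hζ.smooth)
    ((hint hη hζ).add (hint hζ hη))
  rw [intervalIntegral.integral_add (hint hη hζ) (hint hζ hη), hη.suppIn R (by simp),
    hη.suppIn (-R) (by simp), zero_dotProduct, zero_dotProduct, sub_self] at h
  exact eq_neg_of_add_eq_zero_left h

theorem pairing_conformalOp_swap (hU : IsOpen U) (hG : IsMetric U G) (hw : ContDiffOn ℝ ∞ w U)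
    (hu : ContDiff ℝ ∞ u) (huU : ∀ x, u x ∈ U) (hη : IsTestIn R η) (hζ : IsTestIn R ζ) :
    pairing η ((conformalOp G w).op u ζ) = -pairing ζ ((conformalOp G w).op u η) := by
  have hO := isSmoothOn_conformalOp hG hw
  have hc {a : V n → Matrix (Fin n) (Fin n) ℝ} (ha : ContDiffOn ℝ ∞ a U) {ψ : ℝ → V n}
      (hψ : IsTestIn R ψ) := (contDiff_tailDensity ha hu huU hψ.smooth).continuous
  have h1 : ContDiffOn ℝ ∞ (fun _ => 1 : V n → Matrix (Fin n) (Fin n) ℝ) U := contDiffOn_const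
  rw [HydroOp.pairing_op_eq hU hO hu huU hη hζ, HydroOp.pairing_op_eq hU hO hu huU hζ hη,
    Fin.sum_univ_two, Fin.sum_univ_two]
  change (∫ x in (-R)..R, localDensity G u η ζ x)
      + ((∫ x in (-R)..R, tailDensity w u η x * prim R (tailDensity (fun _ => 1) u ζ) x)
        + ∫ x in (-R)..R, tailDensity (fun _ => 1) u η x * prim R (tailDensity w u ζ) x)
    = -((∫ x in (-R)..R, localDensity G u ζ η x)
      + ((∫ x in (-R)..R, tailDensity w u ζ x * prim R (tailDensity (fun _ => 1) u η) x)
        + ∫ x in (-R)..R, tailDensity (fun _ => 1) u ζ x * prim R (tailDensity w u η) x))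
  rw [integral_localDensity_swap hU hG hu huU hη hζ, integral_mul_prim R (hc h1 hζ) (hc hw hη),
    integral_mul_prim R (hc hw hζ) (hc h1 hη)]
  ring

end Operators

section Variation

variable {n m : ℕ} {U : Set (V n)} {G a : V n → Matrix (Fin n) (Fin n) ℝ} {O : HydroOp n m}
  {R : ℝ} {u X ψ η ζ : ℝ → V n} {γ : ℝ × ℝ → V n}

/-- The derivative of `tailDensity a u ψ` as `u` moves with the velocity `X`. -/
def tailVar (a : V n → Matrix (Fin n) (Fin n) ℝ) (u X ψ : ℝ → V n) (x : ℝ) : ℝ :=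
  ψ x ⬝ᵥ (a (u x) *ᵥ deriv X x + fderiv ℝ a (u x) (X x) *ᵥ deriv u x)

/-- The derivative of `conn G u u_x` as `u` moves with the velocity `X`. -/
def connVar (G : V n → Matrix (Fin n) (Fin n) ℝ) (u X : ℝ → V n) (x : ℝ) :
    Matrix (Fin n) (Fin n) ℝ :=
  fderiv ℝ (fun q => conn G q (deriv u x)) (u x) (X x) + conn G (u x) (deriv X x)

/-- The derivative of `localDensity G u η ζ` as `u` moves with the velocity `X`. -/
def localVar (G : V n → Matrix (Fin n) (Fin n) ℝ) (u X η ζ : ℝ → V n) (x : ℝ) : ℝ :=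
  η x ⬝ᵥ (fderiv ℝ G (u x) (X x) *ᵥ covAlong G u ζ x - G (u x) *ᵥ (connVar G u X x)ᵀ *ᵥ ζ x)

/-- The integrand of the derivative of `pairing η (O.op u ζ)` as `u` moves with the velocity `X`.
The primitive of the varied density is moved to the other factor by skew-symmetry. -/
def HydroOp.variation (O : HydroOp n m) (R : ℝ) (u X η ζ : ℝ → V n) (x : ℝ) : ℝ :=
  localVar O.metric u X η ζ x
    + ∑ α, (tailVar (O.left α) u X η x * prim R (tailDensity (O.right α) u ζ) x
      - tailVar (O.right α) u X ζ x * prim R (tailDensity (O.left α) u η) x)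

theorem hasDerivAt_family (hγ : ContDiff ℝ ∞ γ) (ε x : ℝ) :
    HasDerivAt (fun ε => γ (ε, x)) (fderiv ℝ γ (ε, x) (1, 0)) ε :=
  hasDerivAt_prodMk_left (z := (ε, x)) (hγ.differentiable (by simp) _).hasFDerivAt

theorem hasFamilyDeriv_tailDensity (hU : IsOpen U) (ha : ContDiffOn ℝ ∞ a U)
    (hγ : ContDiff ℝ ∞ γ) (hγU : ∀ z, γ z ∈ U) (hψ : ContDiff ℝ ∞ ψ) :
    HasFamilyDeriv (fun ε => tailDensity a (fun x => γ (ε, x)) ψ)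
      (fun ε => tailVar a (fun x => γ (ε, x)) (fun x => fderiv ℝ γ (ε, x) (1, 0)) ψ) := by
  have haγ := ha.comp_contDiff hγ hγU
  refine .of_contDiff ?_ fun ε x => ?_
  · exact contDiff_dotProduct (hψ.comp contDiff_snd)
      (contDiff_mulVec haγ (contDiff_deriv_prodMk_right hγ))
  · exact (hasDerivAt_dotProduct (hasDerivAt_const ε (ψ x))
      (hasDerivAt_mulVec (hasDerivAt_matrix_comp hU ha (hasDerivAt_family hγ ε x) (hγU _))
        (hasDerivAt_deriv_prodMk_right hγ ε x))).congr_deriv (by simp [tailVar])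

theorem hasFamilyDeriv_localDensity (hU : IsOpen U) (hG : IsMetric U G)
    (hγ : ContDiff ℝ ∞ γ) (hγU : ∀ z, γ z ∈ U) (hη : ContDiff ℝ ∞ η) (hζ : ContDiff ℝ ∞ ζ) :
    HasFamilyDeriv (fun ε => localDensity G (fun x => γ (ε, x)) η ζ)
      (fun ε => localVar G (fun x => γ (ε, x)) (fun x => fderiv ℝ γ (ε, x) (1, 0)) η ζ) := by
  have hΓ := hG.contDiff_conn_comp hU hγ hγU (contDiff_deriv_prodMk_right hγ)
  refine .of_contDiff ?_ fun ε x => ?_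
  · exact contDiff_dotProduct (hη.comp contDiff_snd) (contDiff_mulVec
      (hG.contDiffOn.comp_contDiff hγ hγU) (((contDiff_deriv hζ).comp contDiff_snd).sub
        (contDiff_mulVec (contDiff_transpose hΓ) (hζ.comp contDiff_snd))))
  · have hε := hasDerivAt_family hγ ε x
    have hΓε := hG.hasDerivAt_conn hU hε (hγU _) (hasDerivAt_deriv_prodMk_right hγ ε x)
    have hcov := (hasDerivAt_mulVec (hasDerivAt_transpose hΓε)
      (hasDerivAt_const ε (ζ x))).const_sub (deriv ζ x)
    refine (hasDerivAt_dotProduct (hasDerivAt_const ε (η x)) (hasDerivAt_mulVec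
      (hasDerivAt_matrix_comp hU hG.contDiffOn hε (hγU _)) hcov)).congr_deriv ?_
    simp only [Matrix.mulVec_zero, zero_add, zero_dotProduct, add_zero, Matrix.mulVec_neg, localVar,
      connVar, covAlong, sub_eq_neg_add]

theorem HydroOp.hasDerivAt_pairing_op (hU : IsOpen U) (hO : O.IsSmoothOn U)
    (hγ : ContDiff ℝ ∞ γ) (hγU : ∀ z, γ z ∈ U) (hη : IsTestIn R η) (hζ : IsTestIn R ζ) (ε : ℝ) :
    HasDerivAt (fun ε => pairing η (O.op (fun x => γ (ε, x)) ζ))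
      (∫ x in (-R)..R,
        O.variation R (fun x => γ (ε, x)) (fun x => fderiv ℝ γ (ε, x) (1, 0)) η ζ x) ε := by
  have hγε (ε : ℝ) : ContDiff ℝ ∞ fun x => γ (ε, x) := hγ.comp (contDiff_prodMk_right ε)
  have hl := hasFamilyDeriv_localDensity hU hO.metric hγ hγU hη.smooth hζ.smooth
  have hL (α : Fin m) := hasFamilyDeriv_tailDensity hU (hO.left α) hγ hγU hη.smooth
  have hR (α : Fin m) := hasFamilyDeriv_tailDensity hU (hO.right α) hγ hγU hζ.smooth
  have htail (α : Fin m) :=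
    (((hL α).cont_left' ε).fun_mul (continuous_prim R ((hR α).cont_left ε))).fun_sub
      (((hR α).cont_left' ε).fun_mul (continuous_prim R ((hL α).cont_left ε)))
  rw [funext fun ε => pairing_op_eq hU hO (hγε ε) (fun x => hγU (ε, x)) hη hζ]
  refine ((hl.hasDerivAt_integral (-R) R ε).add (HasDerivAt.fun_sum fun α _ =>
    (hL α).hasDerivAt_integral_mul_prim (hR α) R ε)).congr_deriv ?_
  rw [← intervalIntegral.integral_finsetSum fun α _ => (htail α).intervalIntegrable _ _,
    ← intervalIntegral.integral_add ((hl.cont_left' ε).intervalIntegrable _ _)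
      ((continuous_finsetSum _ fun α _ => htail α).intervalIntegrable _ _)]
  rfl

theorem exists_contDiff_mem_eventuallyEq_id {W : Set ℝ} (hW : W ∈ 𝓝 0) :
    ∃ ρ : ℝ → ℝ, ContDiff ℝ ∞ ρ ∧ (∀ ε, ρ ε ∈ W) ∧ ρ =ᶠ[𝓝 0] id := by
  obtain ⟨δ, hδ, hball⟩ := Metric.mem_nhds_iff.1 hW
  let χ : ContDiffBump (0 : ℝ) := ⟨δ / 2, δ, half_pos hδ, half_lt_self hδ⟩
  refine ⟨fun ε => χ ε * ε, χ.contDiff.mul contDiff_id, fun ε => hball ?_, ?_⟩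
  · rw [mem_ball_zero_iff, norm_mul, Real.norm_of_nonneg χ.nonneg]
    rcases lt_or_ge ‖ε‖ δ with h | h
    · exact (mul_le_of_le_one_left (norm_nonneg ε) χ.le_one).trans_lt h
    · simpa [χ.zero_of_le_dist (by simpa using h)] using hδ
  · filter_upwards [χ.eventuallyEq_one] with ε hε
    simp [hε]

-- The field `u + ε X` itself may leave `U` for every `ε ≠ 0`, since `X` need not be bounded.
theorem exists_family_eq_add_smul (hU : IsOpen U) (hu : ContDiff ℝ ∞ u) (huU : ∀ x, u x ∈ U)
    (hX : ContDiff ℝ ∞ X) (r : ℝ) : ∃ γ : ℝ × ℝ → V n, ContDiff ℝ ∞ γ ∧ (∀ z, γ z ∈ U) ∧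
      (∀ x, γ (0, x) = u x) ∧ ∀ᶠ ε in 𝓝 0, ∀ x ∈ Set.Ioo (-r) r, γ (ε, x) = u x + ε • X x := by
  let χ : ContDiffBump (0 : ℝ) := ⟨|r| + 1, |r| + 2, by positivity, by linarith⟩
  have hχ : ∀ x ∈ Set.Ioo (-r) r, χ x = 1 := fun x hx => χ.one_of_mem_closedBall
    (mem_closedBall_zero_iff.2 ((abs_lt.2 hx).le.trans
      ((le_abs_self r).trans (le_add_of_nonneg_right zero_le_one))))
  let Z : ℝ → V n := fun x => χ x • X x
  have hZ : ContDiff ℝ ∞ Z := χ.contDiff.smul hX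
  have hW : ∀ᶠ ε in 𝓝 (0 : ℝ), ∀ x, u x + ε • Z x ∈ U := by
    have hcont : Continuous fun z : ℝ × ℝ => u z.2 + z.1 • Z z.2 := by fun_prop
    have hK := χ.hasCompactSupport.isCompact.eventually_forall_of_forall_eventually
      (P := fun ε x => u x + ε • Z x ∈ U) (x₀ := (0 : ℝ)) fun x _ =>
        hcont.continuousAt.eventually_mem (hU.mem_nhds (by simpa using huU x))
    filter_upwards [hK] with ε hε x
    by_cases hx : x ∈ tsupport χ
    · exact hε x hx
    · simpa [Z, image_eq_zero_of_notMem_tsupport hx] using huU x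
  obtain ⟨ρ, hρ, hρW, hρ0⟩ := exists_contDiff_mem_eventuallyEq_id hW
  refine ⟨fun z => u z.2 + ρ z.1 • Z z.2, ?_, fun z => hρW z.1 z.2, fun x => ?_, ?_⟩
  · fun_prop
  · simp [hρ0.self_of_nhds]
  · filter_upwards [hρ0] with ε hε x hx
    simp [Z, hε, hχ x hx]

theorem HydroOp.hasDerivAt_pairing_op_add_smul (hU : IsOpen U) (hO : O.IsSmoothOn U)
    (hu : ContDiff ℝ ∞ u) (huU : ∀ x, u x ∈ U) (hX : ContDiff ℝ ∞ X) (hη : IsTestIn R η)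
    (hζ : IsTestIn R ζ) :
    HasDerivAt (fun ε : ℝ => pairing η (O.op (u + ε • X) ζ))
      (∫ x in (-R)..R, O.variation R u X η ζ x) 0 := by
  obtain ⟨γ, hγ, hγU, hγ0, hγX⟩ := exists_family_eq_add_smul hU hu huU hX (|R| + 1)
  have hvel : Set.EqOn (fun x => fderiv ℝ γ (0, x) (1, 0)) X (Set.Ioo (-(|R| + 1)) (|R| + 1)) := by
    intro x hx
    have hlin : HasDerivAt (fun ε : ℝ => u x + ε • X x) (X x) 0 := by
      simpa using ((hasDerivAt_id (0 : ℝ)).smul_const (X x)).const_add (u x)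
    exact (hasDerivAt_family hγ 0 x).unique
      (hlin.congr_of_eventuallyEq (hγX.mono fun ε hε => hε x hx))
  have h := hasDerivAt_pairing_op hU hO hγ hγU hη hζ 0
  simp only [hγ0] at h
  refine (h.congr_of_eventuallyEq (hγX.mono fun ε hε => ?_)).congr_deriv
    (intervalIntegral.integral_congr fun x hx => ?_)
  · refine pairing_op_congr hη.suppIn hζ.suppIn fun x hx => (hε x ?_).symm
    exact Set.Ioo_subset_Ioo (by linarith [le_abs_self R]) (by linarith [le_abs_self R]) hx
  · have hx' : x ∈ Set.Ioo (-(|R| + 1)) (|R| + 1) := by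
      have h1 := le_abs_self R
      have h2 := neg_abs_le R
      rcases Set.mem_uIcc.1 hx with h | h <;> constructor <;> linarith
    have hd := (hvel.eventuallyEq_of_mem (isOpen_Ioo.mem_nhds hx')).deriv_eq
    have hv := hvel hx'
    simp only [variation, localVar, connVar, tailVar, hd, hv]

end Variation

section Jacobi

variable {n : ℕ} {U : Set (V n)} {G a w : V n → Matrix (Fin n) (Fin n) ℝ} {p : V n} {R : ℝ}
  {u X ψ ξ η ζ : ℝ → V n} {x : ℝ}

theorem IsCodazzi.hasDerivAt_dotProduct_mulVec (hU : IsOpen U) (ha : IsCodazzi U G a)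
    (ha' : ContDiffOn ℝ ∞ a U) (hu : ContDiff ℝ ∞ u) (hux : u x ∈ U) (hX : ContDiff ℝ ∞ X)
    (hψ : ContDiff ℝ ∞ ψ) :
    HasDerivAt (fun y => ψ y ⬝ᵥ a (u y) *ᵥ X y)
      (tailVar a u X ψ x + covAlong G u ψ x ⬝ᵥ a (u x) *ᵥ X x
        + ψ x ⬝ᵥ conn G (u x) (X x) *ᵥ a (u x) *ᵥ deriv u x) x := by
  have hd {f : ℝ → V n} (hf : ContDiff ℝ ∞ f) := (hf.differentiable (by simp) x).hasDerivAt
  refine (hasDerivAt_dotProduct (hd hψ) (hasDerivAt_mulVec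
    (hasDerivAt_matrix_comp hU ha' (hd hu) hux) (hd hX))).congr_deriv ?_
  have hsymm := congrArg (ψ x ⬝ᵥ ·) (ha (u x) hux (X x) (deriv u x))
  simp only [dotProduct_add, tailVar, covAlong, sub_dotProduct, transpose_mulVec_dotProduct]
    at hsymm ⊢
  linear_combination -hsymm

theorem IsMetric.covAlong_conn_transpose_mulVec (hU : IsOpen U) (hG : IsMetric U G)
    (hu : ContDiff ℝ ∞ u) (hux : u x ∈ U) (hX : ContDiff ℝ ∞ X) (hζ : ContDiff ℝ ∞ ζ) :
    covAlong G u (fun y => (conn G (u y) (X y))ᵀ *ᵥ ζ y) x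
      = (connVar G u X x)ᵀ *ᵥ ζ x - (curvOp G (u x) (X x) (deriv u x))ᵀ *ᵥ ζ x
        + (conn G (u x) (X x))ᵀ *ᵥ covAlong G u ζ x := by
  have hd {f : ℝ → V n} (hf : ContDiff ℝ ∞ f) := (hf.differentiable (by simp) x).hasDerivAt
  have hΓ := hasDerivAt_transpose (hG.hasDerivAt_conn hU (hd hu) hux (hd hX))
  rw [covAlong, (hasDerivAt_mulVec hΓ (hd hζ)).deriv]
  simp only [covAlong, connVar, curvOp, Matrix.transpose_add, Matrix.transpose_sub,
    Matrix.transpose_mul, Matrix.add_mulVec, Matrix.sub_mulVec, Matrix.mulVec_sub,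
    ← Matrix.mulVec_mulVec]
  abel

theorem IsMetric.hasDerivAt_dotProduct_conn (hU : IsOpen U) (hG : IsMetric U G)
    (hu : ContDiff ℝ ∞ u) (huU : ∀ y, u y ∈ U) (hX : ContDiff ℝ ∞ X) (hη : ContDiff ℝ ∞ η)
    (hζ : ContDiff ℝ ∞ ζ) :
    HasDerivAt (fun y => η y ⬝ᵥ G (u y) *ᵥ (conn G (u y) (X y))ᵀ *ᵥ ζ y)
      (ζ x ⬝ᵥ conn G (u x) (X x) *ᵥ G (u x) *ᵥ covAlong G u η x
        - η x ⬝ᵥ conn G (u x) (X x) *ᵥ G (u x) *ᵥ covAlong G u ζ x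
        - η x ⬝ᵥ G (u x) *ᵥ (curvOp G (u x) (X x) (deriv u x))ᵀ *ᵥ ζ x
        - localVar G u X η ζ x) x := by
  have hΓ := contDiff_mulVec (contDiff_transpose (hG.contDiff_conn_comp hU hu huU hX)) hζ
  refine (hG.hasDerivAt_dotProduct_mulVec hU hu (huU x) hη hΓ).congr_deriv ?_
  rw [localDensity, localDensity, hG.covAlong_conn_transpose_mulVec hU hu (huU x) hX hζ, localVar,
    hG.fderiv_eq hU (huU x)]
  simp only [Matrix.neg_mulVec, Matrix.add_mulVec, ← Matrix.mulVec_mulVec, Matrix.mulVec_sub,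
    Matrix.mulVec_add, dotProduct_sub, dotProduct_add, dotProduct_neg, transpose_mulVec_dotProduct]
  ring

/-- The matrix by which the tail of `conformalOp G w`, applied to `ζ`, acts on `u_x`. -/
def tailMatrix (w : V n → Matrix (Fin n) (Fin n) ℝ) (R : ℝ) (u ζ : ℝ → V n) (x : ℝ) :
    Matrix (Fin n) (Fin n) ℝ :=
  prim R (tailDensity (fun _ => 1) u ζ) x • w (u x) + prim R (tailDensity w u ζ) x • 1

theorem contDiff_tailMatrix (hw : ContDiffOn ℝ ∞ w U) (hu : ContDiff ℝ ∞ u) (huU : ∀ y, u y ∈ U)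
    (hζ : ContDiff ℝ ∞ ζ) : ContDiff ℝ ∞ (tailMatrix w R u ζ) :=
  ((contDiff_prim R (contDiff_tailDensity contDiffOn_const hu huU hζ)).smul
    (hw.comp_contDiff hu huU)).add
    ((contDiff_prim R (contDiff_tailDensity hw hu huU hζ)).smul contDiff_const)

theorem tailMatrix_mulVec (X : V n) : tailMatrix w R u ζ x *ᵥ X
    = prim R (tailDensity (fun _ => 1) u ζ) x • w (u x) *ᵥ X
      + prim R (tailDensity w u ζ) x • X := by
  simp only [tailMatrix, Matrix.add_mulVec, Matrix.smul_mulVec, Matrix.one_mulVec]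

theorem tailMatrix_mulVec_comm (X : V n) :
    tailMatrix w R u η x *ᵥ tailMatrix w R u ζ x *ᵥ X
      = tailMatrix w R u ζ x *ᵥ tailMatrix w R u η x *ᵥ X := by
  simp only [tailMatrix_mulVec, Matrix.mulVec_add, Matrix.mulVec_smul]
  module

theorem conformalOp_op_eq (hU : IsOpen U) (hG : IsMetric U G) (hw : ContDiffOn ℝ ∞ w U)
    (hu : ContDiff ℝ ∞ u) (huU : ∀ y, u y ∈ U) (hζ : IsTestIn R ζ) (x : ℝ) :
    (conformalOp G w).op u ζ x
      = G (u x) *ᵥ covAlong G u ζ x + tailMatrix w R u ζ x *ᵥ deriv u x := by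
  rw [HydroOp.op_eq hU (isSmoothOn_conformalOp hG hw) hu huU hζ, tailMatrix_mulVec]
  simp [conformalOp, Fin.sum_univ_two]

/-- The flux whose `x`-derivative is `(conformalOp G w).variation` plus `bracketRemainder`; it
vanishes at `±R` when `η` and `ζ` do. -/
def bracketFlux (G w : V n → Matrix (Fin n) (Fin n) ℝ) (R : ℝ) (u X η ζ : ℝ → V n) (x : ℝ) : ℝ :=
  η x ⬝ᵥ tailMatrix w R u ζ x *ᵥ X x - ζ x ⬝ᵥ tailMatrix w R u η x *ᵥ X x
    - η x ⬝ᵥ G (u x) *ᵥ (conn G (u x) (X x))ᵀ *ᵥ ζ x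

/-- The density that represents, up to sign and a total derivative, the derivative of the bracket
`pairing η (J u ζ)` as `u` moves with the velocity `X`. Unlike `HydroOp.variation`, it contains no
derivative of `X`. -/
def bracketRemainder (G w : V n → Matrix (Fin n) (Fin n) ℝ) (R : ℝ) (u X η ζ : ℝ → V n) (x : ℝ) :
    ℝ :=
  η x ⬝ᵥ conn G (u x) (X x) *ᵥ (conformalOp G w).op u ζ x
    - ζ x ⬝ᵥ conn G (u x) (X x) *ᵥ (conformalOp G w).op u η x
    + covAlong G u η x ⬝ᵥ tailMatrix w R u ζ x *ᵥ X x
    - covAlong G u ζ x ⬝ᵥ tailMatrix w R u η x *ᵥ X x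

namespace IsConformalTail

theorem dotProduct_curvOp_transpose (hG : IsMetric U G) (hw : IsConformalTail U G w) (hp : p ∈ U)
    (X Y η ζ : V n) : η ⬝ᵥ G p *ᵥ (curvOp G p X Y)ᵀ *ᵥ ζ
      = (η ⬝ᵥ Y) * (ζ ⬝ᵥ w p *ᵥ X) - (η ⬝ᵥ X) * (ζ ⬝ᵥ w p *ᵥ Y)
        + (η ⬝ᵥ w p *ᵥ Y) * (ζ ⬝ᵥ X) - (η ⬝ᵥ w p *ᵥ X) * (ζ ⬝ᵥ Y) := by
  have hlower (Z : V n) : (G p)⁻¹ *ᵥ Z ⬝ᵥ G p *ᵥ η = η ⬝ᵥ Z := by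
    rw [mulVec_dotProduct_of_isSymm (hG.isSymm_inv hp), Matrix.mulVec_mulVec, hG.inv_mul hp,
      Matrix.one_mulVec, dotProduct_comm]
  rw [← mulVec_dotProduct_of_isSymm (hG.isSymm hp), dotProduct_comm, transpose_mulVec_dotProduct,
    hw.curvOp_mulVec p hp]
  simp only [hlower, dotProduct_add, dotProduct_sub, dotProduct_smul, smul_eq_mul]

theorem hasDerivAt_dotProduct_tailMatrix (hU : IsOpen U) (hG : IsMetric U G)
    (hw : IsConformalTail U G w) (hu : ContDiff ℝ ∞ u) (huU : ∀ y, u y ∈ U) (hX : ContDiff ℝ ∞ X)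
    (hη : ContDiff ℝ ∞ η) (hζ : ContDiff ℝ ∞ ζ) :
    HasDerivAt (fun y => η y ⬝ᵥ tailMatrix w R u ζ y *ᵥ X y)
      (tailVar w u X η x * prim R (tailDensity (fun _ => 1) u ζ) x
        + tailVar (fun _ => 1) u X η x * prim R (tailDensity w u ζ) x
        + covAlong G u η x ⬝ᵥ tailMatrix w R u ζ x *ᵥ X x
        + η x ⬝ᵥ conn G (u x) (X x) *ᵥ tailMatrix w R u ζ x *ᵥ deriv u x
        + (η x ⬝ᵥ w (u x) *ᵥ X x) * (ζ x ⬝ᵥ deriv u x)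
        + (η x ⬝ᵥ X x) * (ζ x ⬝ᵥ w (u x) *ᵥ deriv u x)) x := by
  have hprim {a : V n → Matrix (Fin n) (Fin n) ℝ} (ha : ContDiffOn ℝ ∞ a U) :=
    hasDerivAt_prim R (contDiff_tailDensity ha hu huU hζ).continuous x
  have hw' := (IsCodazzi.hasDerivAt_dotProduct_mulVec hU hw.codazzi hw.smooth hu (huU x) hX hη).mul
    (hprim contDiffOn_const (a := fun _ => 1))
  have h1' := ((isCodazzi_one hU hG).hasDerivAt_dotProduct_mulVec hU contDiffOn_const hu (huU x) hX
    hη).mul (hprim hw.smooth)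
  refine ((hw'.add h1').congr_of_eventuallyEq (.of_forall fun y => ?_)).congr_deriv ?_
  · simp [tailMatrix_mulVec, mul_comm]
  · simp only [tailMatrix_mulVec, tailDensity, Matrix.one_mulVec, Matrix.mulVec_add,
      Matrix.mulVec_smul, dotProduct_add, dotProduct_smul, smul_eq_mul]
    ring

theorem hasDerivAt_bracketFlux (hU : IsOpen U) (hG : IsMetric U G) (hw : IsConformalTail U G w)
    (hu : ContDiff ℝ ∞ u) (huU : ∀ y, u y ∈ U) (hX : ContDiff ℝ ∞ X) (hη : IsTestIn R η)
    (hζ : IsTestIn R ζ) :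
    HasDerivAt (bracketFlux G w R u X η ζ)
      ((conformalOp G w).variation R u X η ζ x + bracketRemainder G w R u X η ζ x) x := by
  have hηζ := hw.hasDerivAt_dotProduct_tailMatrix hU hG hu huU hX hη.smooth hζ.smooth (x := x)
    (R := R)
  have hζη := hw.hasDerivAt_dotProduct_tailMatrix hU hG hu huU hX hζ.smooth hη.smooth (x := x)
    (R := R)
  have hloc := hG.hasDerivAt_dotProduct_conn hU hu huU hX hη.smooth hζ.smooth (x := x)
  refine ((hηζ.fun_sub hζη).fun_sub hloc).congr_deriv ?_
  rw [hw.dotProduct_curvOp_transpose hG (huU x), HydroOp.variation, Fin.sum_univ_two,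
    bracketRemainder, conformalOp_op_eq hU hG hw.smooth hu huU hη,
    conformalOp_op_eq hU hG hw.smooth hu huU hζ]
  simp only [conformalOp, Matrix.cons_val_zero, Matrix.cons_val_one, Matrix.mulVec_add,
    dotProduct_add]
  ring

theorem contDiff_bracketFlux (hU : IsOpen U) (hG : IsMetric U G) (hw : IsConformalTail U G w)
    (hu : ContDiff ℝ ∞ u) (huU : ∀ y, u y ∈ U) (hX : ContDiff ℝ ∞ X) (hη : ContDiff ℝ ∞ η)
    (hζ : ContDiff ℝ ∞ ζ) : ContDiff ℝ ∞ (bracketFlux G w R u X η ζ) := by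
  have hM {ψ : ℝ → V n} (hψ : ContDiff ℝ ∞ ψ) :=
    contDiff_mulVec (contDiff_tailMatrix (R := R) hw.smooth hu huU hψ) hX
  exact ((contDiff_dotProduct hη (hM hζ)).sub (contDiff_dotProduct hζ (hM hη))).sub
    (contDiff_dotProduct hη (contDiff_mulVec (hG.contDiffOn.comp_contDiff hu huU)
      (contDiff_mulVec (contDiff_transpose (hG.contDiff_conn_comp hU hu huU hX)) hζ)))

theorem contDiff_bracketRemainder (hU : IsOpen U) (hG : IsMetric U G) (hw : IsConformalTail U G w)
    (hu : ContDiff ℝ ∞ u) (huU : ∀ y, u y ∈ U) (hX : ContDiff ℝ ∞ X) (hη : IsTestIn R η)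
    (hζ : IsTestIn R ζ) : ContDiff ℝ ∞ (bracketRemainder G w R u X η ζ) := by
  have hΓ {ψ : ℝ → V n} (hψ : IsTestIn R ψ) := contDiff_mulVec
    (hG.contDiff_conn_comp hU hu huU hX)
    (HydroOp.contDiff_op hU (isSmoothOn_conformalOp hG hw.smooth) hu huU hψ)
  have hM {ψ : ℝ → V n} (hψ : IsTestIn R ψ) :=
    contDiff_mulVec (contDiff_tailMatrix (R := R) hw.smooth hu huU hψ.smooth) hX
  have hcov {ψ : ℝ → V n} (hψ : IsTestIn R ψ) := hG.contDiff_covAlong hU hu huU hψ.smooth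
  exact (((contDiff_dotProduct hη.smooth (hΓ hζ)).sub (contDiff_dotProduct hζ.smooth (hΓ hη))).add
    (contDiff_dotProduct (hcov hη) (hM hζ))).sub (contDiff_dotProduct (hcov hζ) (hM hη))

theorem integral_variation (hU : IsOpen U) (hG : IsMetric U G) (hw : IsConformalTail U G w)
    (hu : ContDiff ℝ ∞ u) (huU : ∀ y, u y ∈ U) (hX : ContDiff ℝ ∞ X) (hη : IsTestIn R η)
    (hζ : IsTestIn R ζ) : ∫ x in (-R)..R, (conformalOp G w).variation R u X η ζ x
      = -∫ x in (-R)..R, bracketRemainder G w R u X η ζ x := by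
  have hT (x : ℝ) := hw.hasDerivAt_bracketFlux hU hG hu huU hX hη hζ (x := x)
  have hTd := hw.contDiff_bracketFlux hU hG hu huU hX hη.smooth hζ.smooth (R := R)
  have hi := (contDiff_deriv hTd).continuous.intervalIntegrable (μ := MeasureTheory.volume) (-R) R
  have hflux : ∫ x in (-R)..R, deriv (bracketFlux G w R u X η ζ) x = 0 := by
    rw [intervalIntegral.integral_deriv_eq_sub
      (fun x _ => (hT x).differentiableAt) hi]
    simp [bracketFlux, hη.suppIn R, hη.suppIn (-R), hζ.suppIn R, hζ.suppIn (-R)]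
  have hrem := (hw.contDiff_bracketRemainder hU hG hu huU hX hη hζ).continuous
  have hsplit : ∫ x in (-R)..R, (conformalOp G w).variation R u X η ζ x = ∫ x in (-R)..R,
      (deriv (bracketFlux G w R u X η ζ) x - bracketRemainder G w R u X η ζ x) :=
    intervalIntegral.integral_congr fun x _ => by simp only [(hT x).deriv, add_sub_cancel_right]
  rw [hsplit, intervalIntegral.integral_sub hi (hrem.intervalIntegrable _ _), hflux, zero_sub]

theorem isSymm_mul_metric (hG : IsMetric U G) (hw : IsConformalTail U G w) (hp : p ∈ U) :
    (w p * G p).IsSymm := by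
  have h : w p * G p = G p * ((G p)⁻¹ * w p) * G p := by
    rw [← Matrix.mul_assoc, hG.mul_inv hp, Matrix.one_mul]
  rw [h, Matrix.IsSymm, Matrix.transpose_mul, Matrix.transpose_mul, hw.isSymm p hp, hG.isSymm hp,
    ← Matrix.mul_assoc (G p)]

theorem dotProduct_tailMatrix_metric_comm (hG : IsMetric U G) (hw : IsConformalTail U G w)
    (hux : u x ∈ U) (α β : V n) :
    α ⬝ᵥ tailMatrix w R u ζ x *ᵥ G (u x) *ᵥ β = β ⬝ᵥ tailMatrix w R u ζ x *ᵥ G (u x) *ᵥ α := by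
  have hwG : α ⬝ᵥ w (u x) *ᵥ G (u x) *ᵥ β = β ⬝ᵥ w (u x) *ᵥ G (u x) *ᵥ α := by
    rw [Matrix.mulVec_mulVec, Matrix.mulVec_mulVec,
      ← mulVec_dotProduct_of_isSymm (hw.isSymm_mul_metric hG hux), dotProduct_comm]
  have hGs : α ⬝ᵥ G (u x) *ᵥ β = β ⬝ᵥ G (u x) *ᵥ α := by
    rw [← mulVec_dotProduct_of_isSymm (hG.isSymm hux), dotProduct_comm]
  simp only [tailMatrix_mulVec, dotProduct_add, dotProduct_smul, hwG, hGs]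

theorem bracketRemainder_cyclic (hU : IsOpen U) (hG : IsMetric U G) (hw : IsConformalTail U G w)
    (hu : ContDiff ℝ ∞ u) (huU : ∀ y, u y ∈ U) (hξ : IsTestIn R ξ) (hη : IsTestIn R η)
    (hζ : IsTestIn R ζ) (x : ℝ) :
    bracketRemainder G w R u ((conformalOp G w).op u ξ) η ζ x
      + bracketRemainder G w R u ((conformalOp G w).op u η) ζ ξ x
      + bracketRemainder G w R u ((conformalOp G w).op u ζ) ξ η x = 0 := by
  have hswap {α β : ℝ → V n} (hα : IsTestIn R α) (hβ : IsTestIn R β) (γ : ℝ → V n) :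
      covAlong G u α x ⬝ᵥ tailMatrix w R u γ x *ᵥ (conformalOp G w).op u β x
        - covAlong G u β x ⬝ᵥ tailMatrix w R u γ x *ᵥ (conformalOp G w).op u α x
      = covAlong G u α x ⬝ᵥ tailMatrix w R u γ x *ᵥ tailMatrix w R u β x *ᵥ deriv u x
        - covAlong G u β x ⬝ᵥ tailMatrix w R u γ x *ᵥ tailMatrix w R u α x *ᵥ deriv u x := by
    rw [conformalOp_op_eq hU hG hw.smooth hu huU hα, conformalOp_op_eq hU hG hw.smooth hu huU hβ,
      Matrix.mulVec_add, Matrix.mulVec_add, dotProduct_add, dotProduct_add,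
      hw.dotProduct_tailMatrix_metric_comm hG (huU x)]
    ring
  have hηξ := hswap hη hξ ζ
  have hζη := hswap hζ hη ξ
  have hξζ := hswap hξ hζ η
  rw [tailMatrix_mulVec_comm (η := ζ) (ζ := ξ), tailMatrix_mulVec_comm (η := ζ) (ζ := η)] at hηξ
  rw [tailMatrix_mulVec_comm (η := ξ) (ζ := η)] at hζη
  have hΓ (X Y : V n) := hG.conn_mulVec_comm hU (huU x) X Y
  simp only [bracketRemainder]
  rw [hΓ ((conformalOp G w).op u η x) ((conformalOp G w).op u ξ x),
    hΓ ((conformalOp G w).op u ζ x) ((conformalOp G w).op u ξ x),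
    hΓ ((conformalOp G w).op u ζ x) ((conformalOp G w).op u η x)]
  linear_combination hηξ + hζη + hξζ

theorem hasDerivAt_pairing_op (hU : IsOpen U) (hG : IsMetric U G) (hw : IsConformalTail U G w)
    (hu : ContDiff ℝ ∞ u) (huU : ∀ y, u y ∈ U) (hξ : IsTestIn R ξ) (hη : IsTestIn R η)
    (hζ : IsTestIn R ζ) :
    HasDerivAt (fun ε : ℝ =>
        pairing η ((conformalOp G w).op (u + ε • (conformalOp G w).op u ξ) ζ))
      (-∫ x in (-R)..R, bracketRemainder G w R u ((conformalOp G w).op u ξ) η ζ x) 0 := by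
  have hO := isSmoothOn_conformalOp hG hw.smooth
  have hX := HydroOp.contDiff_op hU hO hu huU hξ
  rw [← hw.integral_variation hU hG hu huU hX hη hζ]
  exact HydroOp.hasDerivAt_pairing_op_add_smul hU hO hu huU hX hη hζ

theorem integral_bracketRemainder_cyclic (hU : IsOpen U) (hG : IsMetric U G)
    (hw : IsConformalTail U G w) (hu : ContDiff ℝ ∞ u) (huU : ∀ y, u y ∈ U) (hξ : IsTestIn R ξ)
    (hη : IsTestIn R η) (hζ : IsTestIn R ζ) :
    (∫ x in (-R)..R, bracketRemainder G w R u ((conformalOp G w).op u ξ) η ζ x)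
      + (∫ x in (-R)..R, bracketRemainder G w R u ((conformalOp G w).op u η) ζ ξ x)
      + (∫ x in (-R)..R, bracketRemainder G w R u ((conformalOp G w).op u ζ) ξ η x) = 0 := by
  have hO := isSmoothOn_conformalOp hG hw.smooth
  have hi {ξ η ζ : ℝ → V n} (hξ : IsTestIn R ξ) (hη : IsTestIn R η) (hζ : IsTestIn R ζ) :=
    (hw.contDiff_bracketRemainder hU hG hu huU (HydroOp.contDiff_op hU hO hu huU hξ) hη
      hζ).continuous.intervalIntegrable (μ := MeasureTheory.volume) (-R) R
  rw [← intervalIntegral.integral_add (hi hξ hη hζ) (hi hη hζ hξ),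
    ← intervalIntegral.integral_add ((hi hξ hη hζ).add (hi hη hζ hξ)) (hi hζ hξ hη)]
  simp only [hw.bracketRemainder_cyclic hU hG hu huU hξ hη hζ, intervalIntegral.integral_zero]

theorem isHamiltonianOperator (hU : IsOpen U) (hG : IsMetric U G) (hw : IsConformalTail U G w) :
    IsHamiltonianOperator U (conformalOp G w).op := by
  intro u hu huU
  refine ⟨fun ξ hξ => ?_, fun ξ η hξ hη => ?_, fun ξ η ζ hξ hη hζ => ?_⟩
  · obtain ⟨r, hr⟩ := hξ.exists_isTestIn
    exact HydroOp.contDiff_op hU (isSmoothOn_conformalOp hG hw.smooth) hu huU (hr r le_rfl)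
  · obtain ⟨r, hr⟩ := hξ.exists_isTestIn
    obtain ⟨s, hs⟩ := hη.exists_isTestIn
    exact pairing_conformalOp_swap hU hG hw.smooth hu huU (hr _ (le_max_left r s))
      (hs _ (le_max_right r s))
  · obtain ⟨r, hr⟩ := hξ.exists_isTestIn
    obtain ⟨s, hs⟩ := hη.exists_isTestIn
    obtain ⟨t, ht⟩ := hζ.exists_isTestIn
    replace hξ := hr (max r (max s t)) (by simp)
    replace hη := hs (max r (max s t)) (by simp)
    replace hζ := ht (max r (max s t)) (by simp)
    refine ⟨_, _, _, hw.hasDerivAt_pairing_op hU hG hu huU hξ hη hζ,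
      hw.hasDerivAt_pairing_op hU hG hu huU hη hζ hξ,
      hw.hasDerivAt_pairing_op hU hG hu huU hζ hξ hη, ?_⟩
    linear_combination -hw.integral_bracketRemainder_cyclic hU hG hu huU hξ hη hζ

end IsConformalTail

end Jacobi

end HydroRecip

end

open HydroRecip in
theorem theorem2 (n : ℕ) (U : Set (V n)) (hU : IsOpen U)
    (G : V n → Matrix (Fin n) (Fin n) ℝ) (hG : IsMetric U G) (hflat : IsFlat U G)
    (h B A : V n → ℝ) (hh : ContDiffOn ℝ ∞ h U) (hB : ContDiffOn ℝ ∞ B U)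
    (hA : ContDiffOn ℝ ∞ A U) (hB0 : ∀ p ∈ U, B p ≠ 0)
    (v : V n → Matrix (Fin n) (Fin n) ℝ)
    (hv : IsHamiltonianSystem U v (localOp G) h ![])
    (hcons : IsConservationLaw U v B A) :
    -- the reciprocal transformation takes the system to the one with the matrix `B v - A E`
    (∀ (D : Set (ℝ × ℝ)) (u : ℝ × ℝ → V n) (X : ℝ × ℝ → ℝ) (u' : ℝ × ℝ → V n),
      IsSolution U v D u → IsReciprocal B A D u X u' →
        IsSolution U (newMatrix v B A) ((fun z => (X z, z.2)) '' D) u') ∧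
    -- the new operator is Hamiltonian
    IsMetric U (newMetric G B) ∧
    IsHamiltonianOperator U (conformalOp (newMetric G B) (newTail G B)).op ∧
    -- the transformed system is Hamiltonian with it, with the density `h / B`
    (∃ P : V n → ℝ, IsHamiltonianSystem U (newMatrix v B A)
      (conformalOp (newMetric G B) (newTail G B)) (fun p => h p / B p)
      ![fun p => h p / B p, P]) ∧
    -- the new metric is conformally flat, and the new operator of conformally flat type
    IsConformallyFlat U (newMetric G B) ∧
    (∀ p ∈ U, ((newMetric G B p)⁻¹ * newTail G B p).IsSymm) ∧
    (∀ p ∈ U, ∀ i j k : Fin n, covDeriv (newMetric G B) (newTail G B) p k i j =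
      covDeriv (newMetric G B) (newTail G B) p j i k) ∧
    (∀ p ∈ U, ∀ i j k l : Fin n, curvature (newMetric G B) p i j k l =
      newTail G B p i k * (1 : Matrix (Fin n) (Fin n) ℝ) j l
      + newTail G B p j l * (1 : Matrix (Fin n) (Fin n) ℝ) i k
      - newTail G B p j k * (1 : Matrix (Fin n) (Fin n) ℝ) i l
      - newTail G B p i l * (1 : Matrix (Fin n) (Fin n) ℝ) j k) := by
  have hG' := isMetric_newMetric hG hB hB0
  have hw := isConformalTail_newTail hU hG hflat hB hB0
  have hv' : ∀ p ∈ U, v p = hess G h p := fun p hp => eq_hess_of_isHamiltonianSystem hU hG hh hv hp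
  have hf : ContDiffOn ℝ ∞ (fun p => h p / B p) U := hh.div hB hB0
  have hh' : Set.EqOn h (fun p => B p * (h p / B p)) U :=
    fun p hp => (mul_div_cancel₀ (h p) (hB0 p hp)).symm
  exact ⟨fun D u X u' hu hR => hR.isSolution hu hB hA hB0,
    hG',
    hw.isHamiltonianOperator hU hG',
    ⟨tailPrimitive G A B fun p => h p / B p,
      isHamiltonianSystem_newMatrix hU hG hA hB hB0 hf hh' hv' hcons⟩,
    isConformallyFlat_newMetric hU hG hflat hB hB0,
    hw.isSymm,
    fun p hp i j k => hw.covDeriv_comm hU hG' hp i j k,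
    fun p hp i j k l => hw.curvature_eq hU hG' hp i j k l⟩
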